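/- Let $G$ be a countably infinite residually finite (discrete) group and let $\overleftarrow{G}$ be a totally disconnected metric compactification of $G$, i.e. a totally disconnected compact metrizable topological group together with an injective homomorphism $\iota\colon G\to\overleftarrow{G}$ with dense image; $G$ acts on $\overleftarrow{G}$ by $g\cdot y=\iota(g)y$. Let $\sigma$ be the left shift action of $G$ on $\{0,1\}^G$, $(\sigma^g x)(h)=x(g^{-1}h)$. Then there is an irregular Toeplitz array $\eta\in\{0,1\}^G$ such that, with $X=\overline{O_\sigma(\eta)}$ its orbit closure: 1. $\overleftarrow{G}$ is the maximal equicontinuous factor of $(X,\sigma,G)$: it is equicontinuous, and there is a factor map (continuous equivariant surjection) $\pi\colon X\to\overleftarrow{G}$ through which every factor map from $X$ to an equicontinuous compact metrizable $G$-system factors, via a factor map from $\overleftarrow{G}$; 2. $(X,\sigma,G)$ is a topo-isomorphic extension of $\overleftarrow{G}$: there is a factor map $h\colon X\to\overleftarrow{G}$ such that, for every $\sigma$-invariant Borel probability measure $\mu$ on $X$, $h$ restricts to a bimeasurable bijection between an invariant Borel set of full $\mu$-measure and an invariant Borel set of full $h(\mu)$-measure, where $h(\mu)$ is the image measure; 3.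 $(X,\sigma,G)$ is uniquely ergodic: it has exactly one $\sigma$-invariant Borel probability measure. Here $\eta$ is a Toeplitz array if for every $g\in G$ there is a finite index subgroup $\Gamma\le G$ with $\eta(\gamma g)=\eta(g)$ for all $\gamma\in\Gamma$, and a Toeplitz array $\eta$ is irregular if no invariant Borel probability measure on $X$ gives measure $1$ to the set of Toeplitz arrays in $X$. -/

import Mathlib

open Set MeasureTheory Topology

universe u v

namespace ToeplitzDynamics

/-! ### Factor maps, equicontinuity, the maximal equicontinuous factor -/

/-- A factor map: a continuous equivariant surjection. -/
structure IsFactorMap (G : Type*) {X Y : Type*} [SMul G X] [SMul G Y]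
    [TopologicalSpace X] [TopologicalSpace Y] (π : X → Y) : Prop where
  continuous : Continuous π
  surjective : Function.Surjective π
  map_smul : ∀ (g : G) (x : X), π (g • x) = g • π x

/-- The action of `G` on the compact metrizable space `X` is equicontinuous: the family of maps
`x ↦ g • x` is equicontinuous, with respect to the uniformity of `X`, which on a compact
Hausdorff space is unique (and is the one induced by any compatible metric). In particular
every map `x ↦ g • x` is continuous. -/
def IsEquicontinuousSystem (G X : Type*) [SMul G X] [TopologicalSpace X] [CompactSpace X]
    [TopologicalSpace.MetrizableSpace X] : Prop :=
  letI : UniformSpace X := uniformSpaceOfCompactR1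
  Equicontinuous (fun (g : G) (x : X) => g • x)

/-- The system `(Y, G)` is the maximal equicontinuous factor of `(X, G)`: it is equicontinuous,
and there is a factor map `π : X → Y` through which every factor map from `X` to an equicontinuous
system on a compact metrizable space factors. The test systems are taken in the universe of `X`;
as a factor of `X` is the image of a surjection from `X`, every factor of `X` is isomorphic to
one in that universe. -/
def IsMaximalEquicontinuousFactor (G : Type*) (X : Type u) (Y : Type v) [Group G]
    [TopologicalSpace X] [MulAction G X]
    [TopologicalSpace Y] [CompactSpace Y] [TopologicalSpace.MetrizableSpace Y]
    [MulAction G Y] : Prop :=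
  IsEquicontinuousSystem G Y ∧
    ∃ π : X → Y, IsFactorMap G π ∧
      ∀ (Z : Type u) [TopologicalSpace Z] [CompactSpace Z] [TopologicalSpace.MetrizableSpace Z]
        [MulAction G Z], IsEquicontinuousSystem G Z →
        ∀ f : X → Z, IsFactorMap G f → ∃ f' : Y → Z, IsFactorMap G f' ∧ f = f' ∘ π

/-! ### Invariant measures and topo-isomorphic extensions -/

/-- An invariant Borel probability measure of the system `(X, G)`. -/
structure IsInvariantProb (G : Type*) {X : Type*} [SMul G X] [MeasurableSpace X]
    (μ : Measure X) : Prop where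
  isProbabilityMeasure : IsProbabilityMeasure μ
  invariant : SMulInvariantMeasure G X μ

/-- Unique ergodicity: there is exactly one invariant Borel probability measure. -/
def IsUniquelyErgodic (G X : Type*) [SMul G X] [MeasurableSpace X] : Prop :=
  ∃! μ : Measure X, IsInvariantProb G μ

/-- The factor map `h : X → Y` is a measure conjugacy of `μ` onto `ν`: it maps `μ` to `ν` and
restricts to a bimeasurable bijection between invariant conull Borel sets `X' ⊆ X`, `Y' ⊆ Y`. -/
def IsMeasureConjugacy (G : Type*) {X Y : Type*} [SMul G X] [SMul G Y]
    [TopologicalSpace X] [TopologicalSpace Y] [MeasurableSpace X] [MeasurableSpace Y]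
    (h : X → Y) (μ : Measure X) (ν : Measure Y) : Prop :=
  IsFactorMap G h ∧ μ.map h = ν ∧
    ∃ (X' : Set X) (Y' : Set Y),
      MeasurableSet X' ∧ MeasurableSet Y' ∧
      (∀ g : G, (fun x => g • x) '' X' = X') ∧ (∀ g : G, (fun y => g • y) '' Y' = Y') ∧
      μ X'ᶜ = 0 ∧ ν Y'ᶜ = 0 ∧
      ∃ e : X' ≃ᵐ Y', ∀ x : X', (e x : Y) = h x

/-- `(X, G)` is a topo-isomorphic extension of `(Y, G)`: some factor map `h : X → Y` is a measure
conjugacy of `μ` (onto its image measure), for every invariant probability measure `μ`. -/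
def IsTopoIsomorphicExtension (G X Y : Type*) [SMul G X] [SMul G Y]
    [TopologicalSpace X] [TopologicalSpace Y] [MeasurableSpace X] [MeasurableSpace Y] : Prop :=
  ∃ h : X → Y, IsFactorMap G h ∧
    ∀ μ : Measure X, IsInvariantProb G μ → IsMeasureConjugacy G h μ (μ.map h)

/-! ### The full shift and Toeplitz arrays -/

/-- The full shift `A ^ G` over the alphabet `A`. -/
def FullShift (G A : Type*) : Type _ := G → A

section FullShift

variable {G A : Type*}

/-- The product topology (`A` is a finite discrete space in the applications). -/
instance [TopologicalSpace A] : TopologicalSpace (FullShift G A) :=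
  inferInstanceAs (TopologicalSpace (G → A))

/-- The Borel sigma-algebra. -/
instance [TopologicalSpace A] : MeasurableSpace (FullShift G A) := borel _

instance [TopologicalSpace A] : BorelSpace (FullShift G A) := ⟨rfl⟩

/-- The left shift action, `(g • x) h = x (g⁻¹ * h)`. -/
instance [Group G] : MulAction G (FullShift G A) where
  smul g x := fun h => x (g⁻¹ * h)
  one_smul x := by
    funext h
    change x (1⁻¹ * h) = x h
    simp
  mul_smul a b x := by
    funext h
    change x ((a * b)⁻¹ * h) = x (b⁻¹ * (a⁻¹ * h))
    simp [mul_assoc]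

instance [Group G] [TopologicalSpace A] : ContinuousConstSMul G (FullShift G A) where
  continuous_const_smul g :=
    continuous_pi fun h => continuous_apply (A := fun _ : G => A) (g⁻¹ * h)

/-- The orbit closure of `x` under the shift, with the induced action, topology and
Borel sigma-algebra. -/
def orbitClosure [Group G] [TopologicalSpace A] (x : FullShift G A) :
    SubMulAction G (FullShift G A) where
  carrier := closure (MulAction.orbit G x)
  smul_mem' g _ hy := smul_closure_orbit_subset g x (smul_mem_smul_set hy)

/-- `Per(x, Γ, α)`: the positions `g` such that `x` is constantly `α` on `Γ g`. -/
def perSymbol [Group G] (x : FullShift G A) (Γ : Subgroup G) (α : A) : Set G :=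
  {g | ∀ γ ∈ Γ, x (γ * g) = α}

/-- `Per(x, Γ)`, the union of the sets `Per(x, Γ, α)` over all symbols `α`. -/
def per [Group G] (x : FullShift G A) (Γ : Subgroup G) : Set G :=
  ⋃ α : A, perSymbol x Γ α

/-- A Toeplitz array: every position is periodic for some finite index subgroup. -/
def IsToeplitz [Group G] (x : FullShift G A) : Prop :=
  ∀ g : G, ∃ Γ : Subgroup G, Γ.FiniteIndex ∧ g ∈ per x Γ

/-- A Toeplitz array `x` is regular if some invariant probability measure of its orbit closure
gives full measure to the set of Toeplitz arrays in this orbit closure. -/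
def IsRegular [Group G] [TopologicalSpace A] (x : FullShift G A) : Prop :=
  ∃ μ : Measure (orbitClosure x), IsInvariantProb G μ ∧
    μ {y : orbitClosure x | IsToeplitz (y : FullShift G A)} = 1

/-- An irregular Toeplitz array: a Toeplitz array that is not regular. -/
def IsIrregularToeplitz [Group G] [TopologicalSpace A] (x : FullShift G A) : Prop :=
  IsToeplitz x ∧ ¬ IsRegular x

end FullShift

/-! ### The action of a group on its compactification -/

/-- Through the homomorphism `ι : G → K`, the group `G` acts on `K` by left translations,
`g • y = ι g * y`. -/
@[reducible] def translationAction {G K : Type*} [Group G] [Group K] (ι : G →* K) :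
    MulAction G K :=
  MulAction.compHom K ι

end ToeplitzDynamics

/-! For an open window `E` in `K`, each `y` yields the array `windowArray ι E y` with a one at `h`
iff `y⁻¹ * ι h ∈ E`; the array sought is the one of `y = 1`. Let `X` be its orbit closure. If no
nontrivial translation preserves `E` up to its boundary, each `x` in `X` has a unique address `π x`:
it agrees with the array of `π x` wherever the latter does not read the boundary of `E`. Since `ι`
maps `G` off this boundary, the array is Toeplitz and the fibre of `π` over `1` is one point. So
points with equal address are proximal, and `π` is the maximal equicontinuous factor
(`eq_of_address_eq`).

Irregularity needs a boundary of positive Haar measure, which in general endangers unique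
ergodicity. Here `sparse` forces each `x` to differ from the array of its address in at most one
position (`defect_disjoint`). The sets of `x` with a defect at `h` are disjoint and of equal measure
for all `h` in the infinite group `G`, hence null (`ae_eq_windowArray`). So every invariant measure
is the Haar measure carried over by `windowArray ι E`. Such a measure exists because arrays with
`y⁻¹` in a boundary part `D` lie in `X` (`windowArray_mem`) and Haar measure is ergodic; those
arrays are not Toeplitz.

The window is built along a chain of open normal subgroups `V n`. Step `n` places ones in a
punctured coset of `V (n + 1)` and bars later steps from finitely many translates of that coset. The
chain shrinks so fast that the never barred set `D` has an inverse of positive measure. -/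

namespace ToeplitzDynamics

/-! ### Cosets in profinite groups and invariant measures -/

section Profinite

variable {K : Type v} [Group K] [TopologicalSpace K] [IsTopologicalGroup K]

/-- The left coset `k * V`. -/
def cosetSet (k : K) (V : Subgroup K) : Set K := {z | k⁻¹ * z ∈ V}

omit [TopologicalSpace K] [IsTopologicalGroup K] in
theorem mem_cosetSet {k z : K} {V : Subgroup K} : z ∈ cosetSet k V ↔ k⁻¹ * z ∈ V := Iff.rfl

omit [TopologicalSpace K] [IsTopologicalGroup K] in
theorem self_mem_cosetSet (k : K) (V : Subgroup K) : k ∈ cosetSet k V := by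
  simp [cosetSet, V.one_mem]

omit [TopologicalSpace K] [IsTopologicalGroup K] in
theorem cosetSet_eq_of_mem {k z : K} {V : Subgroup K} (h : z ∈ cosetSet k V) :
    cosetSet z V = cosetSet k V := by
  ext w
  rw [mem_cosetSet] at h
  rw [mem_cosetSet, mem_cosetSet, ← V.mul_mem_cancel_left h (y := z⁻¹ * w)]
  simp [mul_assoc]

theorem isClopen_cosetSet (k : K) {V : Subgroup K} (hV : IsOpen (V : Set K)) :
    IsClopen (cosetSet k V) :=
  ⟨(V.isClosed_of_isOpen hV).preimage (continuous_const_mul k⁻¹),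
    hV.preimage (continuous_const_mul k⁻¹)⟩

variable [CompactSpace K] [TotallyDisconnectedSpace K]

theorem exists_normal_open_subset {S : Set K} (hS : S ∈ 𝓝 (1 : K)) :
    ∃ V : Subgroup K, V.Normal ∧ IsOpen (V : Set K) ∧ (V : Set K) ⊆ S := by
  obtain ⟨U, hUS, hU, h1⟩ := mem_nhds_iff.1 hS
  obtain ⟨H, hH⟩ := ProfiniteGrp.exist_openNormalSubgroup_sub_open_nhds_of_one hU h1
  exact ⟨H.toSubgroup, H.isNormal', H.isOpen', hH.trans hUS⟩

theorem exists_cosetSet_subset {k : K} {S : Set K} (hS : S ∈ 𝓝 k) :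
    ∃ V : Subgroup K, V.Normal ∧ IsOpen (V : Set K) ∧ cosetSet k V ⊆ S := by
  have h : (fun z => k * z) ⁻¹' S ∈ 𝓝 (1 : K) :=
    (continuous_const_mul k).continuousAt.preimage_mem_nhds (by simpa using hS)
  obtain ⟨V, hn, ho, hV⟩ := exists_normal_open_subset h
  refine ⟨V, hn, ho, fun z hz => ?_⟩
  simpa using hV hz

/-- A strictly decreasing chain of open normal subgroups that are as small as prescribed. -/
theorem exists_strictAnti_normal_open [T1Space K] [(𝓝[≠] (1 : K)).NeBot]
    (N : Subgroup K) (hN : N.Normal) (hNo : IsOpen (N : Set K))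
    (S : ℕ → Set K) (hS : ∀ n, S n ∈ 𝓝 (1 : K)) :
    ∃ V : ℕ → Subgroup K, V 0 = N ∧ (∀ n, (V n).Normal) ∧ (∀ n, IsOpen (V n : Set K)) ∧
      (∀ n, V (n + 1) < V n) ∧ ∀ n, (V (n + 1) : Set K) ⊆ S n := by
  have step : ∀ (n : ℕ) (W : {W : Subgroup K // W.Normal ∧ IsOpen (W : Set K)}),
      ∃ W' : {W : Subgroup K // W.Normal ∧ IsOpen (W : Set K)},
        W'.1 < W.1 ∧ (W'.1 : Set K) ⊆ S n := by
    rintro n ⟨W, hWn, hWo⟩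
    have hW1 : (W : Set K) ∈ 𝓝 (1 : K) := hWo.mem_nhds W.one_mem
    obtain ⟨x, hxW, hx⟩ : ∃ x ∈ (W : Set K), x ≠ 1 := by
      have h1 : (W : Set K) ∈ 𝓝[≠] (1 : K) := mem_nhdsWithin_of_mem_nhds hW1
      obtain ⟨x, hx⟩ := Filter.nonempty_of_mem
        (Filter.inter_mem h1 (self_mem_nhdsWithin : ({1}ᶜ : Set K) ∈ _))
      exact ⟨x, hx.1, hx.2⟩
    have hx1 : ({x}ᶜ : Set K) ∈ 𝓝 (1 : K) := isOpen_compl_singleton.mem_nhds (Ne.symm hx)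
    obtain ⟨W', h1, h2, h3⟩ :=
      exists_normal_open_subset (Filter.inter_mem (Filter.inter_mem (hS n) hW1) hx1)
    exact ⟨⟨W', h1, h2⟩, ⟨fun z hz => (h3 hz).1.2, fun h => (h3 (h hxW)).2 rfl⟩,
      fun z hz => (h3 hz).1.1⟩
  choose next hlt hsub using step
  let V : ℕ → {W : Subgroup K // W.Normal ∧ IsOpen (W : Set K)} :=
    fun n => Nat.rec ⟨N, hN, hNo⟩ (fun n W => next n W) n
  exact ⟨fun n => (V n).1, rfl, fun n => (V n).2.1, fun n => (V n).2.2,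
    fun n => hlt n (V n), fun n => hsub n (V n)⟩

/-- The cosets of open normal subgroups. -/
def openCosets (K : Type v) [Group K] [TopologicalSpace K] : Set (Set K) :=
  {S | ∃ (k : K) (V : Subgroup K), V.Normal ∧ IsOpen (V : Set K) ∧ S = cosetSet k V}

theorem isTopologicalBasis_openCosets :
    TopologicalSpace.IsTopologicalBasis (openCosets K) := by
  refine TopologicalSpace.isTopologicalBasis_of_isOpen_of_nhds ?_ ?_
  · rintro _ ⟨k, V, -, hV, rfl⟩
    exact (isClopen_cosetSet k hV).2
  · intro k S hk hS
    obtain ⟨V, hn, ho, hV⟩ := exists_cosetSet_subset (hS.mem_nhds hk)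
    exact ⟨_, ⟨k, V, hn, ho, rfl⟩, self_mem_cosetSet k V, hV⟩

omit [IsTopologicalGroup K] [CompactSpace K] [TotallyDisconnectedSpace K] in
theorem isPiSystem_openCosets : IsPiSystem (openCosets K) := by
  rintro _ ⟨k, V, hn, ho, rfl⟩ _ ⟨k', V', hn', ho', rfl⟩ ⟨z, hz, hz'⟩
  refine ⟨z, V ⊓ V', Subgroup.normal_inf_normal V V', ho.inter ho', ?_⟩
  rw [← cosetSet_eq_of_mem hz, ← cosetSet_eq_of_mem hz']
  rfl

variable [SecondCountableTopology K] [MeasurableSpace K] [BorelSpace K]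

/-- A probability measure that is invariant under a dense set of left translations is invariant
under all of them. -/
theorem isMulLeftInvariant_of_dense {μ : Measure K} [IsProbabilityMeasure μ] {A : Set K}
    (hA : Dense A) (hμ : ∀ a ∈ A, μ.map (a * ·) = μ) : μ.IsMulLeftInvariant := by
  refine ⟨fun k => ?_⟩
  have hp : IsProbabilityMeasure (μ.map (k * ·)) :=
    Measure.isProbabilityMeasure_map (measurable_const_mul k).aemeasurable
  refine ext_of_generate_finite (openCosets K) ?_ isPiSystem_openCosets ?_ (by simp)
  · rw [← isTopologicalBasis_openCosets.borel_eq_generateFrom]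
    exact BorelSpace.measurable_eq
  · rintro _ ⟨z, V, hn, ho, rfl⟩
    have hm : MeasurableSet (cosetSet z V) := (isClopen_cosetSet z ho).1.measurableSet
    -- As `V` is normal, translation by `k` acts on its cosets like translation by any `a ∈ k V`.
    obtain ⟨a, haA, ha⟩ := hA.exists_mem_open
      ((isClopen_cosetSet k ho).2) ⟨k, self_mem_cosetSet k V⟩
    conv_rhs => rw [← hμ a haA]
    rw [Measure.map_apply (measurable_const_mul k) hm, Measure.map_apply (measurable_const_mul a) hm]
    congr 1
    ext w
    simp only [mem_preimage, mem_cosetSet] at ha ⊢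
    have h1 : z⁻¹ * (a * w) = (z⁻¹ * k * w) * (w⁻¹ * (k⁻¹ * a) * w⁻¹⁻¹) := by group
    have h2 : w⁻¹ * (k⁻¹ * a) * w⁻¹⁻¹ ∈ V := hn.conj_mem _ ha _
    rw [h1, V.mul_mem_cancel_right h2, mul_assoc]

theorem eq_of_isMulLeftInvariant {μ ν : Measure K} [IsProbabilityMeasure μ]
    [IsProbabilityMeasure ν] [μ.IsMulLeftInvariant] [ν.IsMulLeftInvariant] : μ = ν := by
  have key : ∀ (ρ : Measure K) [IsProbabilityMeasure ρ] [ρ.IsMulLeftInvariant],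
      ρ.IsHaarMeasure := fun ρ _ _ =>
    Measure.isHaarMeasure_of_isCompact_nonempty_interior ρ univ isCompact_univ
      (by simp) (by simp) (by simp)
  have := key μ
  have := key ν
  exact Measure.isHaarMeasure_eq_of_isProbabilityMeasure μ ν

omit [TotallyDisconnectedSpace K] [SecondCountableTopology K] in
theorem exists_isMulLeftInvariant_prob :
    ∃ m : Measure K, IsProbabilityMeasure m ∧ m.IsHaarMeasure :=
  ⟨Measure.haarMeasure ⊤, ⟨by
    simpa using Measure.haarMeasure_self (K₀ := (⊤ : TopologicalSpace.PositiveCompacts K))⟩,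
    inferInstance⟩

end Profinite

/-! ### Windows -/

section Window

variable {G : Type u} [Group G] {K : Type v} [Group K] [TopologicalSpace K]

/-- An open set `E` whose return times along `G` generate an irregular Toeplitz array, together
with a closed part `D` of its boundary. -/
structure IsSparseWindow (ι : G →* K) (E D : Set K) : Prop where
  isOpen : IsOpen E
  -- Yields the Toeplitz property and the one-point fibre over `1`.
  mem_of_mem_closure : ∀ g, ι g ∈ closure E → ι g ∈ E
  -- Yields uniqueness of addresses.
  separates : ∀ t : K, t ≠ 1 → ∃ z, (z ∈ E ∧ t * z ∉ closure E) ∨ (z ∉ closure E ∧ t * z ∈ E)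
  -- Two visits to `E` cannot both occur outside the closed inner part `P`; in the limit, two
  -- defects cannot coexist.
  sparse : ∀ g h : G, g ≠ h → ∃ P ⊆ E, IsClosed P ∧
    ∀ z, z * ι g ∈ E → z * ι h ∈ E → z * ι g ∈ P ∨ z * ι h ∈ P
  isClosed_boundary : IsClosed D
  boundary_subset : D ⊆ closure E \ E
  -- The point `z` shows the pattern of `d` on `F` without reading the boundary, so points near `z`
  -- show it too.
  approximable : ∀ d ∈ D, ∀ F : Finset G, ∃ z, ∀ h ∈ F,
    (d * ι h ∈ E → z * ι h ∈ E) ∧ (d * ι h ∉ E → z * ι h ∉ closure E)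

end Window

/-! ### Inductive construction of the window along a chain of subgroups -/

section Construction

variable {G : Type u} [Group G] {K : Type v} [Group K] (ι : G →* K) (e : ℕ ≃ G)
  (V : ℕ → Subgroup K)

/-- The points of `K` that are removed once the coset `c * V (n + 1)` has been used. -/
def removed (n : ℕ) (c : K) : Set K :=
  -- The first clause serves `sparse` and `approximable`; the second clears a neighbourhood of `ι (e
  -- n)`.
  {z | (∃ i ≤ n, ∃ j ≤ n, z * ι ((e i)⁻¹ * e j) ∈ cosetSet c (V (n + 1))) ∨
    z ∈ cosetSet (ι (e n)) (V (n + 1))}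

/-- An enumeration of the cosets of the subgroups `V k`. -/
def targetCoset (n : ℕ) : Set K := cosetSet (ι (e n.unpair.1)) (V n.unpair.2)

open Classical in
/-- A point of `O`, in the `n`-th coset of the enumeration if possible. -/
noncomputable def pickPoint (n : ℕ) (O : Set K) : K :=
  if h : (targetCoset ι e V n ∩ O).Nonempty then h.some else if h : O.Nonempty then h.some else 1

/-- The part of `K` that is still available before step `n`. -/
noncomputable def available : ℕ → Set K
  | 0 => V 0
  | n + 1 => available n \ removed ι e V n (pickPoint ι e V n (available n))

/-- The representative of the coset used at step `n`. -/
noncomputable def center (n : ℕ) : K := pickPoint ι e V n (available ι e V n)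

/-- The set of ones placed at step `n`. -/
noncomputable def bump (n : ℕ) : Set K :=
  -- The hole keeps the center off the closure of the window, while the ones around it accumulate at
  -- the residue.
  cosetSet (center ι e V n) (V (n + 1)) \ cosetSet (center ι e V n) (V (n + 2))

/-- The union of the sets of ones placed at all steps, and of one set outside `V 0`. -/
noncomputable def window (a : K) : Set K :=
  -- The first piece detects translations in `V 0 \ V 1`; bump `n` detects those in `V (n + 1) \ V
  -- (n + 2)`.
  (cosetSet a (V 0) \ cosetSet a (V 1)) ∪ ⋃ n, bump ι e V n

/-- The points that are never removed. -/
noncomputable def residue : Set K := ⋂ n, available ι e V n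

/-- The conditions on the chain `V` under which the construction works. -/
structure IsAdaptedChain [TopologicalSpace K] : Prop where
  normal : ∀ n, (V n).Normal
  isOpen : ∀ n, IsOpen (V n : Set K)
  lt : ∀ n, V (n + 1) < V n
  small : ∀ S ∈ 𝓝 (1 : K), ∃ n, (V n : Set K) ⊆ S
  avoids : ∀ n, ∀ i ≤ n, ∀ j ≤ n, i ≠ j → ι ((e i)⁻¹ * e j) ∉ V (n + 1)
  nonempty : ∀ n, (available ι e V n).Nonempty

variable {ι e V}

theorem available_succ (n : ℕ) : available ι e V (n + 1) =
    available ι e V n \ removed ι e V n (center ι e V n) := rfl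

theorem available_antitone : Antitone (available ι e V) :=
  antitone_nat_of_succ_le fun n => by rw [available_succ]; exact sdiff_subset

theorem notMem_removed {m n : ℕ} (h : m < n) {z : K} (hz : z ∈ available ι e V n) :
    z ∉ removed ι e V m (center ι e V m) :=
  (available_antitone (Nat.succ_le_of_lt h) hz).2

theorem notMem_center_coset {m n : ℕ} (h : m < n) {z : K} (hz : z ∈ available ι e V n) :
    z ∉ cosetSet (center ι e V m) (V (m + 1)) := fun hz' =>
  notMem_removed h hz (Or.inl ⟨0, Nat.zero_le _, 0, Nat.zero_le _, by simpa using hz'⟩)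

theorem mem_cosetSet_mul {k z w : K} {W : Subgroup K} (hz : z ∈ cosetSet k W) (hw : w ∈ W) :
    z * w ∈ cosetSet k W := by
  rw [mem_cosetSet] at *
  rw [← mul_assoc]
  exact W.mul_mem hz hw

theorem mem_cosetSet_mul_right {k z h : K} {W : Subgroup K} (hW : W.Normal)
    (hz : z ∈ cosetSet k W) : z * h ∈ cosetSet (k * h) W := by
  rw [mem_cosetSet] at *
  have := hW.conj_mem _ hz h⁻¹
  simpa [mul_assoc] using this

theorem mul_mem_cosetSet {z w : K} {W : Subgroup K} (hw : w ∈ W) : z * w ∈ cosetSet z W := by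
  simpa [mem_cosetSet] using hw

variable [TopologicalSpace K]

/-! ### Verification of the window properties -/

namespace IsAdaptedChain

variable (hV : IsAdaptedChain ι e V)
include hV

theorem anti : Antitone V := antitone_nat_of_succ_le fun n => (hV.lt n).le

theorem center_mem (n : ℕ) : center ι e V n ∈ available ι e V n := by
  unfold center pickPoint
  split_ifs with h1 h2
  · exact h1.some_mem.2
  · exact h2.some_mem
  · exact absurd (hV.nonempty n) h2

omit [TopologicalSpace K] hV in
theorem center_mem_target {n : ℕ} (h : (targetCoset ι e V n ∩ available ι e V n).Nonempty) :
    center ι e V n ∈ targetCoset ι e V n := by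
  unfold center pickPoint
  rw [dif_pos h]
  exact h.some_mem.1

/-- By normality, right translation permutes the cosets of `V (m + 1)`, so the removed set is a
union of them. -/
theorem removed_mul {m : ℕ} {c z w : K} (hz : z ∈ removed ι e V m c) (hw : w ∈ V (m + 1)) :
    z * w ∈ removed ι e V m c := by
  rcases hz with ⟨i, hi, j, hj, hz⟩ | hz
  · refine Or.inl ⟨i, hi, j, hj, ?_⟩
    have h := (hV.normal (m + 1)).conj_mem w hw (ι ((e i)⁻¹ * e j))⁻¹
    have := mem_cosetSet_mul hz h
    simpa [mul_assoc] using this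
  · exact Or.inr (mem_cosetSet_mul hz hw)

theorem available_mul {n : ℕ} {z w : K} (hz : z ∈ available ι e V n) (hw : w ∈ V n) :
    z * w ∈ available ι e V n := by
  induction n with
  | zero => exact (V 0).mul_mem hz hw
  | succ n ih =>
    refine ⟨ih hz.1 ((hV.lt n).le hw), fun h => hz.2 ?_⟩
    simpa using hV.removed_mul h ((V (n + 1)).inv_mem hw)

theorem center_coset_subset (n : ℕ) :
    cosetSet (center ι e V n) (V (n + 1)) ⊆ available ι e V n := fun z hz => by
  simpa using hV.available_mul (hV.center_mem n) ((hV.lt n).le hz)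

theorem bump_subset_available (n : ℕ) : bump ι e V n ⊆ available ι e V n :=
  sdiff_subset.trans (hV.center_coset_subset n)

theorem center_coset_disjoint {n m : ℕ} (h : n ≠ m) {z : K}
    (hz : z ∈ cosetSet (center ι e V n) (V (n + 1))) :
    z ∉ cosetSet (center ι e V m) (V (m + 1)) := by
  intro hz'
  rcases lt_or_gt_of_ne h with h | h
  · exact notMem_center_coset h (hV.center_coset_subset m hz') hz
  · exact notMem_center_coset h (hV.center_coset_subset n hz) hz'

theorem exists_cosetSet_subset {d : K} [IsTopologicalGroup K] {S : Set K} (hS : S ∈ 𝓝 d) :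
    ∃ k, cosetSet d (V k) ⊆ S := by
  have h : (fun z => d * z) ⁻¹' S ∈ 𝓝 (1 : K) :=
    (continuous_const_mul d).continuousAt.preimage_mem_nhds (by simpa using hS)
  obtain ⟨n, hn⟩ := hV.small _ h
  exact ⟨n, fun z hz => by simpa using hn hz⟩

/-- The coset of `d` is the target of some step `Nat.pair _ k ≥ k`, and `d` itself, never removed,
shows that the target is still available. -/
theorem exists_center_mem_cosetSet [IsTopologicalGroup K] (hι : DenseRange ι) {d : K}
    (hd : d ∈ residue ι e V) (k : ℕ) : ∃ n, k ≤ n ∧ center ι e V n ∈ cosetSet d (V k) := by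
  obtain ⟨g, hg⟩ := hι.exists_mem_open (isClopen_cosetSet d (hV.isOpen k)).2
    ⟨d, self_mem_cosetSet d _⟩
  have ht : targetCoset ι e V (Nat.pair (e.symm g) k) = cosetSet d (V k) := by
    simpa [targetCoset] using cosetSet_eq_of_mem hg
  refine ⟨Nat.pair (e.symm g) k, Nat.right_le_pair _ _, ?_⟩
  rw [← ht]
  refine center_mem_target ⟨d, ?_, mem_iInter.1 hd _⟩
  rw [ht]
  exact self_mem_cosetSet d _

variable [IsTopologicalGroup K]

theorem isClopen_bump (n : ℕ) : IsClopen (bump ι e V n) :=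
  (isClopen_cosetSet _ (hV.isOpen _)).diff (isClopen_cosetSet _ (hV.isOpen _))

theorem isClopen_outer (a : K) : IsClopen (cosetSet a (V 0) \ cosetSet a (V 1)) :=
  (isClopen_cosetSet _ (hV.isOpen _)).diff (isClopen_cosetSet _ (hV.isOpen _))

theorem isOpen_window (a : K) : IsOpen (window ι e V a) :=
  (hV.isClopen_outer a).2.union (isOpen_iUnion fun n => (hV.isClopen_bump n).2)

/-- The ones placed before step `M`. -/
theorem isClosed_truncation (a : K) (M : ℕ) :
    IsClosed ((cosetSet a (V 0) \ cosetSet a (V 1)) ∪ ⋃ n ∈ Finset.range M, bump ι e V n) :=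
  (hV.isClopen_outer a).1.union (isClosed_biUnion_finset fun n _ => (hV.isClopen_bump n).1)

omit hV [TopologicalSpace K] [IsTopologicalGroup K] in
theorem window_eq_union (a : K) (M : ℕ) : window ι e V a =
    ((cosetSet a (V 0) \ cosetSet a (V 1)) ∪ ⋃ n ∈ Finset.range M, bump ι e V n) ∪
      ⋃ n ≥ M, bump ι e V n := by
  ext z
  simp only [window, mem_union, mem_iUnion, Finset.mem_range, exists_prop, or_assoc]
  refine or_congr_right ⟨?_, ?_⟩
  · rintro ⟨n, hn⟩
    exact (lt_or_ge n M).imp (fun h => ⟨n, h, hn⟩) (fun h => ⟨n, h, hn⟩)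
  · rintro (⟨n, -, hn⟩ | ⟨n, -, hn⟩) <;> exact ⟨n, hn⟩

/-- A point has a neighbourhood in which the window is closed once the late ones avoid a coset. -/
theorem mem_of_mem_closure_window {a z : K} {M k : ℕ}
    (h : ∀ n ≥ M, Disjoint (cosetSet z (V k)) (bump ι e V n))
    (hz : z ∈ closure (window ι e V a)) :
    z ∈ (cosetSet a (V 0) \ cosetSet a (V 1)) ∪ ⋃ n ∈ Finset.range M, bump ι e V n := by
  rw [window_eq_union a M, closure_union, (hV.isClosed_truncation a M).closure_eq] at hz
  refine hz.resolve_right fun hz => ?_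
  have := (isClopen_cosetSet z (hV.isOpen k)).2
  obtain ⟨w, hw, hw'⟩ := mem_closure_iff.1 hz _ this (self_mem_cosetSet z _)
  simp only [mem_iUnion] at hw'
  obtain ⟨n, hn, hw'⟩ := hw'
  exact disjoint_left.1 (h n hn) hw hw'

/-- A coset around `ι g` was removed at step `e.symm g`, so only finitely many clopen pieces come
near `ι g`. -/
theorem window_regular (a : K) (g : G) (hg : ι g ∈ closure (window ι e V a)) :
    ι g ∈ window ι e V a := by
  have h := hV.mem_of_mem_closure_window (M := e.symm g + 1) (k := e.symm g + 1) ?_ hg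
  · rw [window_eq_union a (e.symm g + 1)]
    exact Or.inl h
  · intro n hn
    refine disjoint_left.2 fun z hz hz' => ?_
    exact notMem_removed (Nat.lt_of_succ_le hn) (hV.bump_subset_available n hz')
      (Or.inr (by simpa using hz))

/-- Earlier bumps miss the center, its own bump has a hole there, and later bumps avoid its whole
coset. -/
theorem center_notMem_closure {a : K} (ha : a ∉ V 0) (n : ℕ) :
    center ι e V n ∉ closure (window ι e V a) := by
  intro h
  have hc : center ι e V n ∈ V 0 := available_antitone (Nat.zero_le n) (hV.center_mem n)
  have := hV.mem_of_mem_closure_window (M := n) (k := n + 2) ?_ h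
  · rcases this with h | h
    · apply ha
      simpa using (V 0).mul_mem hc ((V 0).inv_mem h.1)
    · simp only [mem_iUnion, Finset.mem_range] at h
      obtain ⟨m, hm, h⟩ := h
      exact notMem_center_coset hm (hV.center_mem n) h.1
  · intro m hm
    refine disjoint_left.2 fun z hz hz' => ?_
    rcases hm.eq_or_lt with rfl | hm
    · exact hz'.2 hz
    · exact hV.center_coset_disjoint hm.ne ((hV.lt _).le hz) hz'.1

theorem window_separates (hι : DenseRange ι) {a : K} (ha : a ∉ V 0)
    (hD : (residue ι e V).Nonempty) [T1Space K] {t : K} (ht : t ≠ 1) :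
    ∃ z, (z ∈ window ι e V a ∧ t * z ∉ closure (window ι e V a)) ∨
      (z ∉ closure (window ι e V a) ∧ t * z ∈ window ι e V a) := by
  have outer_sub : cosetSet a (V 0) \ cosetSet a (V 1) ⊆ window ι e V a := subset_union_left
  have bump_sub : ∀ n, bump ι e V n ⊆ window ι e V a := fun n =>
    (subset_iUnion (bump ι e V) n).trans subset_union_right
  by_cases ht0 : t ∈ V 0
  · -- some level of the chain separates `t` from `1`
    obtain ⟨n, htn, htn'⟩ : ∃ n, t ∈ V n ∧ t ∉ V (n + 1) := by
      by_contra! hcon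
      have hall : ∀ n, t ∈ V n := fun n => Nat.rec ht0 (fun n ih => hcon n ih) n
      obtain ⟨n, hn⟩ := hV.small {t}ᶜ (isOpen_compl_singleton.mem_nhds (Ne.symm ht))
      exact hn (hall n) rfl
    have conj : ∀ (z : K) (m : ℕ), z⁻¹ * (t * z) ∈ V m ↔ t ∈ V m := fun z m => by
      have := (hV.normal m).mem_comm_iff (a := z⁻¹) (b := t * z)
      rw [this]; simp
    cases n with
    | zero =>
      refine ⟨a, Or.inr ⟨fun h => ?_, outer_sub ⟨(conj a 0).2 htn, fun h => htn' ((conj a 1).1 h)⟩⟩⟩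
      have := hV.mem_of_mem_closure_window (M := 0) (k := 0) ?_ h
      · rcases this with h | h
        · exact h.2 (self_mem_cosetSet a _)
        · simp at h
      · intro m _
        refine disjoint_left.2 fun z hz hz' => ha ?_
        have h0 : z ∈ V 0 :=
          available_antitone (Nat.zero_le m) (hV.bump_subset_available m hz')
        have h1 : (a⁻¹ * z)⁻¹ ∈ V 0 := (V 0).inv_mem hz
        simpa using (V 0).mul_mem h0 h1
    | succ n =>
      exact ⟨center ι e V n, Or.inr ⟨hV.center_notMem_closure ha n, bump_sub n
        ⟨(conj _ _).2 htn, fun h => htn' ((conj _ _).1 h)⟩⟩⟩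
  -- Arbitrarily near `d` there are centers, off the closure of the window, and bump points, inside
  -- it. Whichever kind disagrees with the behaviour at `t * d`, outside `V 0`, is the witness.
  · obtain ⟨d, hd⟩ := hD
    have hd0 : d ∈ V 0 := mem_iInter.1 hd 0
    by_cases hout : t * d ∈ cosetSet a (V 0) \ cosetSet a (V 1)
    · have hnhds : (fun z => t * z) ⁻¹' (cosetSet a (V 0) \ cosetSet a (V 1)) ∈ 𝓝 d :=
        (continuous_const_mul t).continuousAt.preimage_mem_nhds
          ((hV.isClopen_outer a).2.mem_nhds hout)
      obtain ⟨k, hk⟩ := hV.exists_cosetSet_subset hnhds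
      obtain ⟨n, -, hn⟩ := hV.exists_center_mem_cosetSet hι hd k
      exact ⟨center ι e V n, Or.inr ⟨hV.center_notMem_closure ha n, outer_sub (hk hn)⟩⟩
    · have hcl : IsClosed ((cosetSet a (V 0) \ cosetSet a (V 1)) ∪ (V 0 : Set K)) :=
        (hV.isClopen_outer a).1.union ((V 0).isClosed_of_isOpen (hV.isOpen 0))
      have hsub : closure (window ι e V a) ⊆
          (cosetSet a (V 0) \ cosetSet a (V 1)) ∪ (V 0 : Set K) :=
        closure_minimal (union_subset_union_right _ (iUnion_subset fun n =>
          (hV.bump_subset_available n).trans (available_antitone (Nat.zero_le n)))) hcl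
      have htd : t * d ∈ (closure (window ι e V a))ᶜ := fun h => by
        rcases hsub h with h | h
        · exact hout h
        · exact ht0 (((V 0).mul_mem_cancel_right hd0).1 h)
      have hnhds : (fun z => t * z) ⁻¹' (closure (window ι e V a))ᶜ ∈ 𝓝 d :=
        (continuous_const_mul t).continuousAt.preimage_mem_nhds
          (isClosed_closure.isOpen_compl.mem_nhds htd)
      obtain ⟨k, hk⟩ := hV.exists_cosetSet_subset hnhds
      obtain ⟨n, hkn, hn⟩ := hV.exists_center_mem_cosetSet hι hd k
      obtain ⟨x, hx, hx'⟩ := SetLike.exists_of_lt (hV.lt (n + 1))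
      refine ⟨center ι e V n * x, Or.inl ⟨bump_sub n ⟨mul_mem_cosetSet hx, fun h => hx' ?_⟩,
        hk (mem_cosetSet_mul hn (hV.anti (hkn.trans n.le_succ) hx))⟩⟩
      simpa [mem_cosetSet] using h

/-- `P` consists of the ones placed before both `g` and `h` are enumerated. Later on, a one at `z *
ι g` from step `n` removes `z * ι h` from all later steps, and `avoids` excludes the same step. -/
theorem window_sparse {a : K} {g h : G} (hgh : g ≠ h) :
    ∃ P ⊆ window ι e V a, IsClosed P ∧ ∀ z, z * ι g ∈ window ι e V a →
      z * ι h ∈ window ι e V a → z * ι g ∈ P ∨ z * ι h ∈ P := by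
  refine ⟨_, (window_eq_union a (max (e.symm g) (e.symm h))).ge.trans' subset_union_left, hV.isClosed_truncation a (max (e.symm g) (e.symm h)), fun z hzg hzh => ?_⟩
  rw [window_eq_union a (max (e.symm g) (e.symm h))] at hzg hzh
  by_contra! hcon
  have key : ∀ (g h : G) (n m : ℕ), e.symm g ≤ n → e.symm h ≤ n → n < m →
      z * ι g ∈ bump ι e V n → z * ι h ∈ bump ι e V m → False := by
    intro g h n m hg hh hnm hzg hzh
    refine notMem_removed hnm (hV.bump_subset_available m hzh)
      (Or.inl ⟨e.symm h, hh, e.symm g, hg, ?_⟩)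
    simpa [mul_assoc] using hzg.1
  have hzg := hzg.resolve_left hcon.1
  have hzh := hzh.resolve_left hcon.2
  simp only [mem_iUnion] at hzg hzh
  obtain ⟨n, hn, hzg⟩ := hzg
  obtain ⟨m, hm, hzh⟩ := hzh
  have hn := max_le_iff.1 hn
  have hm := max_le_iff.1 hm
  rcases lt_trichotomy n m with hnm | rfl | hnm
  · exact key g h n m hn.1 hn.2 hnm hzg hzh
  · refine hV.avoids n (e.symm g) hn.1 (e.symm h) hn.2 (fun h' => hgh (e.symm.injective h')) ?_
    have := (V (n + 1)).mul_mem ((V (n + 1)).inv_mem hzg.1) hzh.1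
    simpa [mul_assoc] using this
  · exact key h g m n hm.2 hm.1 hnm hzh hzg

theorem isClosed_available (n : ℕ) : IsClosed (available ι e V n) := by
  induction n with
  | zero => exact (V 0).isClosed_of_isOpen (hV.isOpen 0)
  | succ n ih =>
    refine ih.sdiff (isOpen_iff_mem_nhds.2 fun z hz => ?_)
    refine Filter.mem_of_superset
      ((isClopen_cosetSet z (hV.isOpen (n + 1))).2.mem_nhds (self_mem_cosetSet z _)) fun w hw => ?_
    simpa using hV.removed_mul hz hw

theorem isClosed_residue : IsClosed (residue ι e V) :=
  isClosed_iInter fun n => hV.isClosed_available n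

theorem residue_subset (hι : DenseRange ι) {a : K} (ha : a ∉ V 0) :
    residue ι e V ⊆ closure (window ι e V a) \ window ι e V a := by
  intro d hd
  refine ⟨mem_closure_iff_nhds.2 fun S hS => ?_, ?_⟩
  · obtain ⟨k, hk⟩ := hV.exists_cosetSet_subset hS
    obtain ⟨n, hkn, hn⟩ := hV.exists_center_mem_cosetSet hι hd k
    obtain ⟨x, hx, hx'⟩ := SetLike.exists_of_lt (hV.lt (n + 1))
    refine ⟨center ι e V n * x, hk (mem_cosetSet_mul hn (hV.anti (hkn.trans n.le_succ) hx)),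
      Or.inr (mem_iUnion.2 ⟨n, mul_mem_cosetSet hx, fun h => hx' ?_⟩)⟩
    simpa [mem_cosetSet] using h
  · rintro (h | h)
    · apply ha
      have hd0 : d ∈ V 0 := mem_iInter.1 hd 0
      simpa using (V 0).mul_mem hd0 ((V 0).inv_mem h.1)
    · obtain ⟨n, hn⟩ := mem_iUnion.1 h
      exact notMem_center_coset n.lt_succ_self (mem_iInter.1 hd (n + 1)) hn.1

/-- The witness is a late center close to `d`: the pieces placed before step `M` look the same from
there, and no later bump comes near its translates by `F`. -/
theorem window_approximable (hι : DenseRange ι) (a : K) {d : K} (hd : d ∈ residue ι e V)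
    (F : Finset G) : ∃ z, ∀ h ∈ F, (d * ι h ∈ window ι e V a → z * ι h ∈ window ι e V a) ∧
      (d * ι h ∉ window ι e V a → z * ι h ∉ closure (window ι e V a)) := by
  set E := window ι e V a with hE
  obtain ⟨M, hM1, hMF⟩ : ∃ M, e.symm 1 ≤ M ∧ ∀ h ∈ F, e.symm h ≤ M :=
    ⟨max (e.symm 1) (F.sup e.symm), le_max_left _ _,
      fun h hh => (Finset.le_sup (f := e.symm) hh).trans (le_max_right _ _)⟩
  set P := (cosetSet a (V 0) \ cosetSet a (V 1)) ∪ ⋃ n ∈ Finset.range M, bump ι e V n with hP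
  have hPE : P ⊆ E := by
    rw [hE, window_eq_union a M]
    exact subset_union_left
  have hk : ∃ S ∈ 𝓝 d, ∀ z ∈ S, ∀ h ∈ F,
      (d * ι h ∈ E → z * ι h ∈ E) ∧ (d * ι h ∉ E → z * ι h ∉ P) := by
    have hev : ∀ h ∈ F, ∀ᶠ z in 𝓝 d,
        (d * ι h ∈ E → z * ι h ∈ E) ∧ (d * ι h ∉ E → z * ι h ∉ P) := by
      intro h _
      have hc : ContinuousAt (fun z => z * ι h) d := (continuous_mul_const (ι h)).continuousAt
      by_cases hd : d * ι h ∈ E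
      · filter_upwards [hc.preimage_mem_nhds ((hV.isOpen_window a).mem_nhds hd)] with z hz
        exact ⟨fun _ => hz, fun h => absurd hd h⟩
      · filter_upwards [hc.preimage_mem_nhds ((hV.isClosed_truncation a M).isOpen_compl.mem_nhds
          (fun h => hd (hPE h)))] with z hz
        exact ⟨fun h => absurd h hd, fun _ => hz⟩
    exact ⟨_, (Filter.eventually_all_finset F).2 hev, fun z hz => hz⟩
  obtain ⟨S, hS, hSF⟩ := hk
  obtain ⟨k, hk⟩ := hV.exists_cosetSet_subset hS
  obtain ⟨n, hn, hc⟩ := hV.exists_center_mem_cosetSet hι hd (max k M)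
  have hMn : M ≤ n := (le_max_right _ _).trans hn
  have hcS : center ι e V n ∈ S := hk (hV.anti (le_max_left k M) hc)
  refine ⟨center ι e V n, fun h hh => ⟨(hSF _ hcS h hh).1, fun hdh hcl => ?_⟩⟩
  refine (hSF _ hcS h hh).2 hdh (hV.mem_of_mem_closure_window (M := M) (k := n + 2) ?_ hcl)
  intro m hm
  refine disjoint_left.2 fun w hw hw' => ?_
  have hh1 : e.symm h ≤ M := hMF h hh
  -- For `m < n` the center would have been removed at step `m`; for `m > n` the bump point would
  -- have been removed at step `n`. For `m = n`, `avoids` leaves only `h = 1`, where the hole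
  -- intervenes.
  rcases lt_trichotomy m n with hmn | rfl | hmn
  · refine notMem_removed hmn (hV.center_mem n)
      (Or.inl ⟨e.symm 1, hM1.trans hm, e.symm h, hh1.trans hm, ?_⟩)
    have hv : w⁻¹ * (center ι e V n * ι h) ∈ V (m + 1) := by
      have := (V (n + 2)).inv_mem hw
      exact hV.anti (by omega : m + 1 ≤ n + 2) (by simpa [mul_assoc] using this)
    simpa using mem_cosetSet_mul hw'.1 hv
  · have hw2 : w * (ι h)⁻¹ ∈ cosetSet (center ι e V m) (V (m + 2)) := by
      simpa using mem_cosetSet_mul_right (hV.normal _) hw (h := (ι h)⁻¹)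
    have h1 : h = 1 := by
      by_contra hne
      refine hV.avoids m (e.symm 1) (hM1.trans hm) (e.symm h) (hh1.trans hm)
        (fun h' => hne (e.symm.injective h').symm) ?_
      have h3 := (V (m + 1)).mul_mem ((V (m + 1)).inv_mem ((hV.lt _).le hw2)) hw'.1
      simpa [mul_assoc] using h3
    subst h1
    exact hw'.2 (by simpa using hw2)
  · refine notMem_removed hmn (hV.bump_subset_available m hw')
      (Or.inl ⟨e.symm h, by omega, e.symm 1, by omega, ?_⟩)
    have hw2 : w * (ι h)⁻¹ ∈ cosetSet (center ι e V n) (V (n + 2)) := by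
      simpa using mem_cosetSet_mul_right (hV.normal _) hw (h := (ι h)⁻¹)
    have hw3 : w * (ι h)⁻¹ ∈ cosetSet (center ι e V n) (V (n + 1)) := (hV.lt _).le hw2
    simpa using hw3

theorem isSparseWindow (hι : DenseRange ι) {a : K} (ha : a ∉ V 0)
    (hD : (residue ι e V).Nonempty) [T1Space K] :
    IsSparseWindow ι (window ι e V a) (residue ι e V) where
  isOpen := hV.isOpen_window a
  mem_of_mem_closure := hV.window_regular a
  separates _ ht := hV.window_separates hι ha hD ht
  sparse _ _ hgh := hV.window_sparse hgh
  isClosed_boundary := hV.isClosed_residue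
  boundary_subset := hV.residue_subset hι ha
  approximable _ hd F := hV.window_approximable hι a hd F

end IsAdaptedChain

end Construction

/-! ### Existence of a window with a boundary of positive measure -/

section Existence

variable {G : Type u} [Group G] {K : Type v} [Group K] {ι : G →* K} {e : ℕ ≃ G}
  {V : ℕ → Subgroup K}

theorem residue_eq : residue ι e V =
    (V 0 : Set K) \ ⋃ n, removed ι e V n (center ι e V n) := by
  ext z
  simp only [residue, mem_iInter, Set.mem_sdiff, mem_iUnion, not_exists]
  refine ⟨fun h => ⟨h 0, fun n => (h (n + 1)).2⟩, fun h n => ?_⟩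
  induction n with
  | zero => exact h.1
  | succ n ih => exact ⟨ih, h.2 n⟩

variable [TopologicalSpace K] [IsTopologicalGroup K] [MeasurableSpace K] [BorelSpace K]
  {m : Measure K} [m.IsMulLeftInvariant]

/-- For normal `W` this set is the left translate of `W` by `k * c⁻¹`. -/
theorem measure_inv_mul_mem_cosetSet {W : Subgroup K} (hW : W.Normal) (c k : K) :
    m {y | y⁻¹ * k ∈ cosetSet c W} = m (W : Set K) := by
  have : {y | y⁻¹ * k ∈ cosetSet c W} = (fun y => (k * c⁻¹)⁻¹ * y) ⁻¹' (W : Set K) := by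
    ext y
    rw [mem_ofPred_eq, mem_cosetSet, mem_preimage, SetLike.mem_coe, hW.mem_comm_iff,
      ← W.inv_mem_iff]
    simp [mul_assoc]
  rw [this, measure_preimage_mul]

/-- One coset for each pair `(i, j)`, plus the one around `ι (e n)`. Inverses enter because the
array of `y` reads `y⁻¹`. -/
theorem measure_inv_removed_le {n : ℕ} (hW : (V (n + 1)).Normal) (c : K) :
    m (removed ι e V n c)⁻¹ ≤ ((n + 1) * (n + 1) + 1 : ℕ) * m (V (n + 1) : Set K) := by
  have hsub : (removed ι e V n c)⁻¹ ⊆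
      (⋃ p ∈ Finset.range (n + 1) ×ˢ Finset.range (n + 1),
        {y | y⁻¹ * ι ((e p.1)⁻¹ * e p.2) ∈ cosetSet c (V (n + 1))}) ∪
      {y | y⁻¹ * 1 ∈ cosetSet (ι (e n)) (V (n + 1))} := by
    rintro y (⟨i, hi, j, hj, h⟩ | h)
    · refine Or.inl (mem_iUnion₂.2 ⟨(i, j), ?_, h⟩)
      simpa [Nat.lt_succ_iff] using ⟨hi, hj⟩
    · exact Or.inr (by simpa using h)
  refine (measure_mono hsub).trans ((measure_union_le _ _).trans ?_)
  rw [measure_inv_mul_mem_cosetSet hW, Nat.cast_add, add_mul]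
  refine add_le_add ((measure_biUnion_finset_le _ _).trans_eq ?_) (by simp)
  simp only [measure_inv_mul_mem_cosetSet hW, Finset.sum_const, Finset.card_product,
    Finset.card_range, nsmul_eq_mul]

variable (m) in
theorem measure_inv_residue_pos [IsFiniteMeasure m] (hVn : ∀ n, (V n).Normal)
    (hV : ∑' n : ℕ, (((n + 1) * (n + 1) + 1 : ℕ) * m (V (n + 1) : Set K)) < m (V 0 : Set K)) :
    0 < m (residue ι e V)⁻¹ := by
  have h1 : m (⋃ n, (removed ι e V n (center ι e V n))⁻¹) < m (V 0 : Set K) :=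
    ((measure_iUnion_le _).trans
      (ENNReal.tsum_le_tsum fun n => measure_inv_removed_le (hVn _) _)).trans_lt hV
  rw [residue_eq]
  have h2 : ((V 0 : Set K) \ ⋃ n, removed ι e V n (center ι e V n))⁻¹ =
      (V 0 : Set K) \ ⋃ n, (removed ι e V n (center ι e V n))⁻¹ := by
    ext z; simp
  rw [h2]
  exact (tsub_pos_of_lt h1).trans_le le_measure_sdiff

end Existence

theorem exists_isSparseWindow {G : Type u} [Group G] [Countable G] [Infinite G]
    {K : Type v} [Group K] [TopologicalSpace K] [IsTopologicalGroup K] [CompactSpace K]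
    [TopologicalSpace.MetrizableSpace K] [TotallyDisconnectedSpace K]
    [MeasurableSpace K] [BorelSpace K]
    (ι : G →* K) (hι_injective : Function.Injective ι) (hι_dense : DenseRange ι)
    (m : Measure K) [IsProbabilityMeasure m] [m.IsHaarMeasure] :
    ∃ E D : Set K, IsSparseWindow ι E D ∧ 0 < m D⁻¹ := by
  let := TopologicalSpace.metrizableSpaceMetric K
  have hK : Infinite K := Infinite.of_injective ι hι_injective
  have hne : (𝓝[≠] (1 : K)).NeBot := by
    refine ⟨fun h => ?_⟩
    have h1 : IsOpen ({1} : Set K) := isOpen_singleton_iff_punctured_nhds _ |>.2 h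
    have := discreteTopology_of_isOpen_singleton_one h1
    have := finite_of_compact_of_discrete (X := K)
    exact not_finite K
  obtain ⟨a, ha⟩ := exists_ne (1 : K)
  obtain ⟨N, hNn, hNo, hNa⟩ := exists_normal_open_subset
    (isOpen_compl_singleton.mem_nhds (Ne.symm ha) : ({a}ᶜ : Set K) ∈ 𝓝 1)
  have hN : m (N : Set K) ≠ 0 := (hNo.measure_pos m ⟨1, N.one_mem⟩).ne'
  obtain ⟨ε, hε, hεN⟩ := ENNReal.exists_pos_sum_of_countable' hN ℕ
  obtain ⟨e⟩ : Nonempty (ℕ ≃ G) := by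
    obtain ⟨h⟩ := nonempty_denumerable G
    exact ⟨(Denumerable.eqv G).symm⟩
  obtain ⟨B, hB⟩ := (𝓝 (1 : K)).exists_antitone_basis
  -- Dividing by the number of cosets removed at step `n` makes the total removed measure at most
  -- the sum of the `ε n`.
  have hsmall : ∀ n : ℕ, ∃ S ∈ 𝓝 (1 : K), m S ≤ ε n / ((n + 1) * (n + 1) + 1 : ℕ) := by
    intro n
    have : m {(1 : K)} < ε n / ((n + 1) * (n + 1) + 1 : ℕ) := by
      rw [measure_singleton]
      exact ENNReal.div_pos (hε n).ne' (ENNReal.natCast_ne_top _)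
    obtain ⟨U, hU, hUo, hUm⟩ := Set.exists_isOpen_lt_of_lt _ _ this
    exact ⟨U, hUo.mem_nhds (hU rfl), hUm.le⟩
  choose S hS hSm using hsmall
  let Q : ℕ → Set K := fun n => ⋃ i ∈ Finset.range (n + 1), ⋃ j ∈ Finset.range (n + 1),
    {x | i ≠ j ∧ x = ι ((e i)⁻¹ * e j)}
  have hQ : ∀ n, (Q n)ᶜ ∈ 𝓝 (1 : K) := by
    intro n
    have hfin : (Q n).Finite := by
      refine Set.Finite.biUnion (Finset.finite_toSet _) fun i _ =>
        Set.Finite.biUnion (Finset.finite_toSet _) fun j _ =>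
          (finite_singleton (ι ((e i)⁻¹ * e j))).subset fun x hx => hx.2
    refine hfin.isClosed.isOpen_compl.mem_nhds fun h => ?_
    simp only [Q, mem_iUnion] at h
    obtain ⟨i, -, j, -, hij, h⟩ := h
    have h1 : (e i)⁻¹ * e j = 1 := hι_injective (by rw [← h, map_one])
    exact hij (e.injective (inv_mul_eq_one.1 h1))
  obtain ⟨V, rfl, hVn, hVo, hVlt, hVS⟩ := exists_strictAnti_normal_open N hNn hNo
    (fun n => S n ∩ (Q n)ᶜ ∩ B n)
    (fun n => Filter.inter_mem (Filter.inter_mem (hS n) (hQ n)) (hB.1.mem_of_mem trivial))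
  have hpos : 0 < m (residue ι e V)⁻¹ := by
    refine measure_inv_residue_pos m hVn (lt_of_le_of_lt (ENNReal.tsum_le_tsum fun n => ?_) hεN)
    refine (mul_le_mul_right ((measure_mono fun x hx => (hVS n hx).1.1).trans (hSm n)) _).trans ?_
    exact ENNReal.mul_div_le
  have hD : (residue ι e V).Nonempty := by
    rw [← Set.nonempty_inv]
    exact nonempty_of_measure_ne_zero hpos.ne'
  have hV : IsAdaptedChain ι e V :=
    { normal := hVn
      isOpen := hVo
      lt := hVlt
      small := fun T hT => by
        obtain ⟨n, -, hn⟩ := hB.1.mem_iff.1 hT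
        exact ⟨n + 1, fun x hx => hn (hVS n hx).2⟩
      avoids := fun n i hi j hj hij h => (hVS n h).1.2 (by
        simp only [Q, mem_iUnion]
        exact ⟨i, Finset.mem_range.2 (Nat.lt_succ_of_le hi), j,
          Finset.mem_range.2 (Nat.lt_succ_of_le hj), hij, rfl⟩)
      nonempty := fun n => hD.mono (iInter_subset _ n) }
  exact ⟨_, _, hV.isSparseWindow hι_dense (fun h => hNa h rfl) hD, hpos⟩

/-! ### The array generated by a window and its address map -/

section Array

variable {G : Type u} [Group G] {K : Type v} [Group K]

open Classical in
/-- The array that reads off the visits of the orbit of `y` to the window `E`. -/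
noncomputable def windowArray (ι : G →* K) (E : Set K) (y : K) : FullShift G (Fin 2) :=
  fun h => if y⁻¹ * ι h ∈ E then 1 else 0

theorem windowArray_of_mem {ι : G →* K} {E : Set K} {y : K} {h : G} (hy : y⁻¹ * ι h ∈ E) :
    windowArray ι E y h = 1 := if_pos hy

theorem windowArray_of_notMem {ι : G →* K} {E : Set K} {y : K} {h : G} (hy : y⁻¹ * ι h ∉ E) :
    windowArray ι E y h = 0 := if_neg hy

theorem smul_windowArray (ι : G →* K) (E : Set K) (y : K) (g : G) :
    g • windowArray ι E y = windowArray ι E (ι g * y) := by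
  funext h
  have : y⁻¹ * ι (g⁻¹ * h) = (ι g * y)⁻¹ * ι h := by simp [mul_assoc]
  change windowArray ι E y (g⁻¹ * h) = _
  by_cases hy : (ι g * y)⁻¹ * ι h ∈ E
  · rw [windowArray_of_mem hy, windowArray_of_mem (this ▸ hy)]
  · rw [windowArray_of_notMem hy, windowArray_of_notMem (this ▸ hy)]

variable [TopologicalSpace K]

/-- The array `x` agrees with `windowArray ι E y` where the latter is robust. -/
def IsAddress (ι : G →* K) (E : Set K) (x : FullShift G (Fin 2)) (y : K) : Prop :=
  ∀ h, (y⁻¹ * ι h ∈ E → x h = 1) ∧ (y⁻¹ * ι h ∉ closure E → x h = 0)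

variable {ι : G →* K} {E D : Set K}

theorem isAddress_windowArray (y : K) : IsAddress ι E (windowArray ι E y) y := fun _ =>
  ⟨windowArray_of_mem, fun hy => windowArray_of_notMem fun h => hy (subset_closure h)⟩

theorem IsAddress.smul {x : FullShift G (Fin 2)} {y : K} (h : IsAddress ι E x y) (g : G) :
    IsAddress ι E (g • x) (ι g * y) := fun k => by
  have := h (g⁻¹ * k)
  rw [map_mul, map_inv, ← mul_assoc, ← mul_inv_rev] at this
  exact this

variable [IsTopologicalGroup K]

/-- A separating point persists on an open set; this set meets the image of `ι`, where `x` would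
have to be both `1` and `0`. -/
theorem IsSparseWindow.address_unique (hE : IsSparseWindow ι E D) (hι : DenseRange ι)
    {x : FullShift G (Fin 2)} {y y' : K} (hy : IsAddress ι E x y) (hy' : IsAddress ι E x y') :
    y = y' := by
  have key : ∀ y y' z : K, IsAddress ι E x y → IsAddress ι E x y' → z ∈ E →
      (y'⁻¹ * y) * z ∉ closure E → False := by
    intro y y' z hy hy' hz hz'
    have ho : IsOpen {w | y⁻¹ * w ∈ E ∧ y'⁻¹ * w ∈ (closure E)ᶜ} :=
      (hE.isOpen.preimage (continuous_const_mul _)).inter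
        (isClosed_closure.isOpen_compl.preimage (continuous_const_mul _))
    obtain ⟨h, h1, h2⟩ := hι.exists_mem_open ho
      ⟨y * z, by simpa using hz, by simpa [mul_assoc] using hz'⟩
    have h3 := (hy h).1 h1
    rw [(hy' h).2 h2] at h3
    exact absurd h3 (by decide)
  by_contra hne
  obtain ⟨z, ⟨h1, h2⟩ | ⟨h1, h2⟩⟩ := hE.separates (y'⁻¹ * y)
    (fun h => hne (inv_mul_eq_one.1 h).symm)
  · exact key y y' z hy hy' h1 h2
  · exact key y' y _ hy' hy h2 (by simpa [mul_assoc] using h1)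

omit [Group G] in
theorem continuous_coord (h : G) : Continuous fun x : FullShift G (Fin 2) => x h :=
  continuous_apply (A := fun _ : G => Fin 2) h

theorem isClosed_isAddress (hE : IsOpen E) :
    IsClosed {p : FullShift G (Fin 2) × K | IsAddress ι E p.1 p.2} := by
  simp only [IsAddress, ofPred_forall, ofPred_and]
  refine isClosed_iInter fun h => IsClosed.inter ?_ ?_
  · have hc : Continuous fun p : FullShift G (Fin 2) × K => p.2⁻¹ * ι h := by fun_prop
    have hx : IsClosed {p : FullShift G (Fin 2) × K | p.1 h = 1} :=
      isClosed_eq ((continuous_coord h).comp continuous_fst) continuous_const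
    exact (isClosed_imp (hE.preimage hc) hx)
  · have hc : Continuous fun p : FullShift G (Fin 2) × K => p.2⁻¹ * ι h := by fun_prop
    have hx : IsClosed {p : FullShift G (Fin 2) × K | p.1 h = 0} :=
      isClosed_eq ((continuous_coord h).comp continuous_fst) continuous_const
    exact (isClosed_imp (isClosed_closure.isOpen_compl.preimage hc) hx)

instance : CompactSpace (FullShift G (Fin 2)) := inferInstanceAs (CompactSpace (G → Fin 2))

instance : T2Space (FullShift G (Fin 2)) := inferInstanceAs (T2Space (G → Fin 2))

omit [TopologicalSpace K] [IsTopologicalGroup K] in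
theorem windowArray_mem_orbitClosure (g : G) :
    windowArray ι E (ι g) ∈ orbitClosure (windowArray ι E 1) := by
  refine subset_closure ⟨g, ?_⟩
  simpa using smul_windowArray ι E 1 g

omit [TopologicalSpace K] [IsTopologicalGroup K] in
theorem smul_mem_orbitClosure_iff {y : K} (g : G) :
    windowArray ι E (ι g * y) ∈ orbitClosure (windowArray ι E 1) ↔
      windowArray ι E y ∈ orbitClosure (windowArray ι E 1) := by
  rw [← smul_windowArray]
  exact SubMulAction.smul_mem_iff' (p := orbitClosure (windowArray ι E 1)) g

omit [TopologicalSpace K] [IsTopologicalGroup K] in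
instance : CompactSpace (orbitClosure (windowArray ι E 1)) :=
  isCompact_iff_compactSpace.1 (isClosed_closure.isCompact)

omit [TopologicalSpace K] [IsTopologicalGroup K] in
/-- Every nonempty open subset of the orbit closure contains a point of the orbit. -/
theorem exists_windowArray_mem {U : Set (orbitClosure (windowArray ι E 1))} (hU : IsOpen U)
    (hne : U.Nonempty) : ∃ g : G, ⟨windowArray ι E (ι g), windowArray_mem_orbitClosure g⟩ ∈ U := by
  obtain ⟨x, hx⟩ := hne
  obtain ⟨W, hW, rfl⟩ := isOpen_induced_iff.1 hU
  obtain ⟨_, hz, g, rfl⟩ := mem_closure_iff.1 x.2 W hW hx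
  refine ⟨g, ?_⟩
  have : g • windowArray ι E 1 = windowArray ι E (ι g) := by
    simpa using smul_windowArray ι E 1 g
  change windowArray ι E (ι g) ∈ W
  rw [← this]
  exact hz

/-- Orbit points have addresses, and projecting the closed address relation along compact `K` gives
a closed set. -/
theorem exists_address [CompactSpace K] (hE : IsOpen E) :
    ∃ π : orbitClosure (windowArray ι E 1) → K,
      ∀ x : orbitClosure (windowArray ι E 1), IsAddress ι E x (π x) := by
  have hc : IsClosed (Prod.fst '' {p : FullShift G (Fin 2) × K | IsAddress ι E p.1 p.2}) :=
    isClosedMap_fst_of_compactSpace _ (isClosed_isAddress hE)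
  have hsub : closure (MulAction.orbit G (windowArray ι E 1)) ⊆
      Prod.fst '' {p : FullShift G (Fin 2) × K | IsAddress ι E p.1 p.2} := by
    refine closure_minimal ?_ hc
    rintro _ ⟨g, rfl⟩
    exact ⟨(_, ι g * 1), (isAddress_windowArray 1).smul g, rfl⟩
  have : ∀ x : orbitClosure (windowArray ι E 1), ∃ y,
      IsAddress ι E x y := fun x => by
    obtain ⟨⟨_, y⟩, hy, rfl⟩ := hsub x.2
    exact ⟨y, hy⟩
  exact ⟨fun x => (this x).choose, fun x => (this x).choose_spec⟩

/-! ### The address map as maximal equicontinuous factor -/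

namespace IsSparseWindow

variable (hE : IsSparseWindow ι E D) (hι : DenseRange ι)
  {π : orbitClosure (windowArray ι E 1) → K} (hπ :
    ∀ x : orbitClosure (windowArray ι E 1), IsAddress ι E x (π x))
include hE hι hπ

theorem address_windowArray {y : K} (hy : windowArray ι E y ∈ orbitClosure (windowArray ι E 1)) :
    π ⟨windowArray ι E y, hy⟩ = y :=
  hE.address_unique hι (hπ _) (isAddress_windowArray y)

theorem address_smul (g : G) (x : orbitClosure (windowArray ι E 1)) :
    π (g • x) = ι g * π x :=
  hE.address_unique hι (hπ _) ((hπ x).smul g)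

theorem continuous_address [CompactSpace K] : Continuous π := by
  refine continuous_iff_isClosed.2 fun C hC => ?_
  have h1 : IsClosed {p : orbitClosure (windowArray ι E 1) × K |
      IsAddress ι E (p.1 : FullShift G (Fin 2)) p.2} :=
    (isClosed_isAddress hE.isOpen).preimage
      ((continuous_subtype_val.comp continuous_fst).prodMk continuous_snd)
  have h2 := isClosedMap_fst_of_compactSpace _ (h1.inter (hC.preimage continuous_snd))
  convert h2
  ext x
  constructor
  · exact fun hx => ⟨(x, π x), ⟨hπ x, hx⟩, rfl⟩
  · rintro ⟨⟨_, y⟩, ⟨h1, h2⟩, rfl⟩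
    rw [mem_preimage, hE.address_unique hι (hπ _) h1]
    exact h2

theorem surjective_address [CompactSpace K] [T2Space K] : Function.Surjective π := by
  have hc := hE.continuous_address hι hπ
  have h1 : IsClosed (range π) := (isCompact_range hc).isClosed
  have h2 : range ι ⊆ range π := by
    rintro _ ⟨g, rfl⟩
    exact ⟨_, hE.address_windowArray hι hπ (windowArray_mem_orbitClosure g)⟩
  rw [← range_eq_univ, ← univ_subset_iff, ← hι.closure_range]
  exact closure_minimal h2 h1

omit hι [IsTopologicalGroup K] in
theorem eq_of_address_eq_one {x : orbitClosure (windowArray ι E 1)} (hx : π x = 1) :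
    (x : FullShift G (Fin 2)) = windowArray ι E 1 := by
  funext h
  have h1 := hπ x h
  rw [hx] at h1
  by_cases hh : (1 : K)⁻¹ * ι h ∈ E
  · rw [h1.1 hh, windowArray_of_mem hh]
  · rw [h1.2 fun hc => hh ?_, windowArray_of_notMem hh]
    simpa using hE.mem_of_mem_closure h (by simpa using hc)

theorem isFactorMap_address [CompactSpace K] [T2Space K] [MulAction G K]
    (hact : ∀ (g : G) (y : K), g • y = ι g * y) : IsFactorMap G π :=
  ⟨hE.continuous_address hι hπ, hE.surjective_address hι hπ, fun g x => by
    rw [hact, hE.address_smul hι hπ]⟩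

/-- Points with the same address are proximal, hence have the same image in every equicontinuous
factor. -/
theorem eq_of_address_eq [CompactSpace K] [T2Space K] {Z : Type*} [TopologicalSpace Z] [CompactSpace Z]
    [TopologicalSpace.MetrizableSpace Z] [MulAction G Z] (hZ : IsEquicontinuousSystem G Z)
    {f : orbitClosure (windowArray ι E 1) → Z} (hf : IsFactorMap G f)
    {x x' : orbitClosure (windowArray ι E 1)} (hxx : π x = π x') : f x = f x' := by
  let : UniformSpace Z := uniformSpaceOfCompactR1
  have hu : UniformEquicontinuous (fun (g : G) (z : Z) => g • z) :=
    CompactSpace.uniformEquicontinuous_of_equicontinuous hZ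
  refine eq_of_forall_symmetric fun {U} hU _ => ?_
  obtain ⟨U', hU', hsymm, hcomp⟩ := comp_symm_mem_uniformity_sets (hu U hU)
  set x₀ : orbitClosure (windowArray ι E 1) :=
    ⟨windowArray ι E 1, subset_closure (MulAction.mem_orbit_self _)⟩
  have hOx : {w | (f w, f x₀) ∈ U'} ∈ 𝓝 x₀ :=
    hf.continuous.continuousAt.preimage_mem_nhds (mem_nhds_right (f x₀) hU')
  obtain ⟨O, hO, hOo, hOx⟩ := mem_nhds_iff.1 hOx
  have hπc := hE.continuous_address hι hπ
  have hcl : IsClosed (π '' Oᶜ) := (hOo.isClosed_compl.isCompact.image hπc).isClosed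
  have h1 : (1 : K) ∈ (π '' Oᶜ)ᶜ := by
    rintro ⟨w, hw, hw1⟩
    exact hw ((Subtype.ext (hE.eq_of_address_eq_one hπ hw1) : w = x₀) ▸ hOx)
  -- With `ι g` near `(π x)⁻¹`, the whole fibre of `x` moves close to `x₀`, the only point over `1`;
  -- equicontinuity then allows translating back by `g⁻¹`.
  obtain ⟨g, hg⟩ := hι.exists_mem_open (hcl.isOpen_compl.preimage (continuous_mul_const (π x)))
    ⟨(π x)⁻¹, by simpa using h1⟩
  have hmem : ∀ w, π w = π x → (f (g • w), f x₀) ∈ U' := fun w hw => hO (by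
    by_contra hcon
    exact hg ⟨g • w, hcon, by rw [hE.address_smul hι hπ, hw]⟩)
  have h2 := @hcomp (f (g • x), f (g • x'))
    ⟨f x₀, hmem x rfl, hsymm.symm _ _ (hmem x' hxx.symm)⟩ g⁻¹
  simpa [← hf.map_smul] using h2

theorem isMaximalEquicontinuousFactor [CompactSpace K] [TopologicalSpace.MetrizableSpace K]
    [MulAction G K] (hact : ∀ (g : G) (y : K), g • y = ι g * y) :
    IsMaximalEquicontinuousFactor G (orbitClosure (windowArray ι E 1)) K := by
  refine ⟨?_, π, hE.isFactorMap_address hι hπ hact, ?_⟩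
  · let : UniformSpace K := uniformSpaceOfCompactR1
    intro y₀ U hU
    have h := isCompact_univ (X := K).eventually_forall_of_forall_eventually (x₀ := y₀)
      (P := fun y k => (k * y₀, k * y) ∈ U) fun k _ => by
        have hc : Continuous fun p : K × K => (p.2 * y₀, p.2 * p.1) := by fun_prop
        exact hc.continuousAt.preimage_mem_nhds (nhds_le_uniformity (k * y₀) hU)
    filter_upwards [h] with y hy g
    simpa only [hact] using hy (ι g) (mem_univ _)
  · intro Z _ _ _ _ hZ f hf
    have hπf := hE.isFactorMap_address hι hπ hact
    have hq : IsQuotientMap π := hπf.continuous.isClosedMap.isQuotientMap hπf.continuous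
      hπf.surjective
    choose s hs using hπf.surjective
    have hfs : ∀ x, f (s (π x)) = f x := fun x =>
      hE.eq_of_address_eq hι hπ hZ hf (hs (π x))
    refine ⟨f ∘ s, ⟨hq.continuous_iff.2 ?_, fun z => ?_, fun g y => ?_⟩, ?_⟩
    · convert hf.continuous using 1
      exact funext hfs
    · obtain ⟨x, rfl⟩ := hf.surjective z
      exact ⟨π x, hfs x⟩
    · obtain ⟨x, rfl⟩ := hπf.surjective y
      simp only [Function.comp_apply]
      rw [← hπf.map_smul, hfs, hfs, hf.map_smul]
    · exact (funext hfs).symm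

end IsSparseWindow

end Array

/-! ### Invariant measures of the orbit closure -/

theorem measurable_fullShift {G : Type*} [Countable G] {Ω : Type*} [MeasurableSpace Ω]
    {f : Ω → FullShift G (Fin 2)} (hf : ∀ h, Measurable fun ω => f ω h) : Measurable f := by
  have h1 : Measurable[_, MeasurableSpace.pi] (fun ω => (f ω : G → Fin 2)) :=
    measurable_pi_iff.2 hf
  have h2 : borel (G → Fin 2) = MeasurableSpace.pi := BorelSpace.measurable_eq.symm
  rw [← h2] at h1
  exact h1

theorem image_smul_eq_of_forall {G Y : Type*} [Group G] [MulAction G Y] {S : Set Y}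
    (hS : ∀ g : G, ∀ y ∈ S, g • y ∈ S) (g : G) : (fun y => g • y) '' S = S :=
  Subset.antisymm (image_subset_iff.2 (hS g)) fun y hy =>
    ⟨g⁻¹ • y, hS _ _ hy, smul_inv_smul g y⟩

section Measure

variable {G : Type u} [Group G] {K : Type v} [Group K] [TopologicalSpace K] [IsTopologicalGroup K]
  [MeasurableSpace K] [BorelSpace K] {ι : G →* K} {E D : Set K}

theorem measurable_windowArray [Countable G] (hE : IsOpen E) : Measurable (windowArray ι E) := by
  refine measurable_fullShift fun h => ?_
  have : MeasurableSet {y : K | y⁻¹ * ι h ∈ E} :=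
    (hE.preimage (continuous_inv.mul continuous_const)).measurableSet
  classical
  unfold windowArray
  convert Measurable.ite this (measurable_const (a := (1 : Fin 2))) measurable_const

theorem measurableSet_mem_orbitClosure [Countable G] (hE : IsOpen E) :
    MeasurableSet {y | windowArray ι E y ∈ orbitClosure (windowArray ι E 1)} :=
  measurable_windowArray hE isClosed_closure.measurableSet

/-- A probability measure on `K` that is invariant under the dense subgroup is the Haar measure. -/
theorem eq_haar_of_invariant [CompactSpace K] [TotallyDisconnectedSpace K]
    [SecondCountableTopology K] (hι : DenseRange ι) {m ν : Measure K} [IsProbabilityMeasure m]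
    [m.IsMulLeftInvariant] [IsProbabilityMeasure ν] (hν : ∀ g, ν.map (ι g * ·) = ν) : ν = m := by
  have : ν.IsMulLeftInvariant := isMulLeftInvariant_of_dense hι (by
    rintro _ ⟨g, rfl⟩
    exact hν g)
  exact eq_of_isMulLeftInvariant

/-- The Haar measure is ergodic for the translations by a dense subgroup. -/
theorem measure_compl_eq_zero_of_invariant [CompactSpace K] [TotallyDisconnectedSpace K]
    [SecondCountableTopology K] (hι : DenseRange ι) {m : Measure K} [IsProbabilityMeasure m]
    [m.IsMulLeftInvariant] {Y : Set K} (hY : MeasurableSet Y)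
    (hinv : ∀ g y, ι g * y ∈ Y ↔ y ∈ Y) (hpos : m Y ≠ 0) : m Yᶜ = 0 := by
  have := ProbabilityTheory.cond_isProbabilityMeasure hpos
  -- Conditioning on an invariant set gives an invariant probability measure, and there is only one.
  have heq : ProbabilityTheory.cond m Y = m := by
    refine eq_haar_of_invariant hι fun g => Measure.ext fun S hS => ?_
    rw [Measure.map_apply (measurable_const_mul _) hS, ProbabilityTheory.cond_apply hY,
      ProbabilityTheory.cond_apply hY]
    congr 1
    rw [← measure_preimage_mul m (ι g) (Y ∩ S)]
    congr 1
    ext y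
    simp [hinv]
  rw [← heq, ProbabilityTheory.cond_apply hY]
  simp

-- The pattern on `F` supplied by `approximable` is locally constant around `z`, so some `ι g` near
-- `z` realises it on the orbit.
omit [MeasurableSpace K] [BorelSpace K] in
theorem IsSparseWindow.windowArray_mem (hE : IsSparseWindow ι E D) (hι : DenseRange ι) {y : K}
    (hy : y⁻¹ ∈ D) : windowArray ι E y ∈ orbitClosure (windowArray ι E 1) := by
  refine mem_closure_iff.2 fun U hU hyU => ?_
  obtain ⟨F, u, hu, hsub⟩ := isOpen_pi_iff.1 (hU : IsOpen (X := G → Fin 2) U) _ hyU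
  obtain ⟨z, hz⟩ := hE.approximable _ hy F
  have hev : ∀ h ∈ F, ∀ᶠ w in 𝓝 z, windowArray ι E w⁻¹ h = windowArray ι E y h := by
    intro h hh
    have hc : ContinuousAt (fun z => z * ι h) z := (continuous_mul_const (ι h)).continuousAt
    by_cases hd : y⁻¹ * ι h ∈ E
    · filter_upwards [hc.preimage_mem_nhds (hE.isOpen.mem_nhds ((hz h hh).1 hd))] with w hw
      rw [windowArray_of_mem hd, windowArray_of_mem (by simpa using hw)]
    · filter_upwards [hc.preimage_mem_nhds
        (isClosed_closure.isOpen_compl.mem_nhds ((hz h hh).2 hd))] with w hw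
      rw [windowArray_of_notMem hd,
        windowArray_of_notMem (by simpa using fun h => hw (subset_closure h))]
  obtain ⟨S, hS, hSo, hzS⟩ := mem_nhds_iff.1 ((Filter.eventually_all_finset F).2 hev)
  obtain ⟨g, hg⟩ := hι.exists_mem_open hSo ⟨z, hzS⟩
  refine ⟨g⁻¹ • windowArray ι E 1, hsub fun h hh => ?_, ⟨g⁻¹, rfl⟩⟩
  have := hS hg h hh
  rw [smul_windowArray, map_inv, mul_one, this]
  exact (hu h hh).2

section

variable [Countable G] [CompactSpace K] [TotallyDisconnectedSpace K] [SecondCountableTopology K]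
  {m : Measure K} [IsProbabilityMeasure m] [m.IsMulLeftInvariant]

theorem IsSparseWindow.measure_mem_orbitClosure (hE : IsSparseWindow ι E D) (hι : DenseRange ι)
    (hD : 0 < m D⁻¹) :
    m {y | windowArray ι E y ∈ orbitClosure (windowArray ι E 1)}ᶜ = 0 := by
  refine measure_compl_eq_zero_of_invariant hι (measurableSet_mem_orbitClosure hE.isOpen)
    (fun g y => smul_mem_orbitClosure_iff g) ?_
  exact (hD.trans_le (measure_mono fun y hy => hE.windowArray_mem hι hy)).ne'

end

/-! ### Almost sure reconstruction from the address and unique ergodicity -/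

namespace IsSparseWindow

variable (hE : IsSparseWindow ι E D) (hι : DenseRange ι)
  {π : orbitClosure (windowArray ι E 1) → K} (hπ :
    ∀ x : orbitClosure (windowArray ι E 1), IsAddress ι E x (π x))
  {μ : Measure (orbitClosure (windowArray ι E 1))} (hμ : IsInvariantProb G μ)
include hE hι hπ

-- A defect is a one of `x` where its address reads a point outside `E`, hence outside `P`. Both
-- conditions are open, so two defects would pass to an orbit point, where they are true visits to
-- `E` outside `P`.
omit [MeasurableSpace K] [BorelSpace K] in
theorem defect_disjoint [CompactSpace K] {g h : G} (hgh : g ≠ h)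
    {x : orbitClosure (windowArray ι E 1)}
    (hg : (x : FullShift G (Fin 2)) g ≠ windowArray ι E (π x) g) :
    (x : FullShift G (Fin 2)) h = windowArray ι E (π x) h := by
  by_contra hh
  have hout : ∀ k, (x : FullShift G (Fin 2)) k ≠ windowArray ι E (π x) k →
      (π x)⁻¹ * ι k ∉ E ∧ (x : FullShift G (Fin 2)) k ≠ 0 := by
    intro k hk
    have hk' : (π x)⁻¹ * ι k ∉ E := fun hmem =>
      hk (by rw [(hπ x k).1 hmem, windowArray_of_mem hmem])
    exact ⟨hk', by rwa [windowArray_of_notMem hk'] at hk⟩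
  obtain ⟨P, hPE, hP, hPs⟩ := hE.sparse g h hgh
  have hπc := hE.continuous_address hι hπ
  have ho : ∀ k, IsOpen {w : orbitClosure (windowArray ι E 1) |
      (π w)⁻¹ * ι k ∈ Pᶜ ∧ (w : FullShift G (Fin 2)) k ∈ ({0}ᶜ : Set (Fin 2))} := fun k =>
    (hP.isOpen_compl.preimage (hπc.inv.mul continuous_const)).inter
      ((isOpen_discrete ({0}ᶜ : Set (Fin 2))).preimage ((continuous_coord k).comp continuous_subtype_val))
  obtain ⟨k, ⟨hk1, hk2⟩, ⟨hk3, hk4⟩⟩ := exists_windowArray_mem ((ho g).inter (ho h))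
    ⟨x, ⟨fun h' => (hout g hg).1 (hPE h'), (hout g hg).2⟩,
      ⟨fun h' => (hout h hh).1 (hPE h'), (hout h hh).2⟩⟩
  rw [hE.address_windowArray hι hπ] at hk1 hk3
  have hmem : ∀ l, windowArray ι E (ι k) l ∈ ({0}ᶜ : Set (Fin 2)) → (ι k)⁻¹ * ι l ∈ E :=
    fun l hl => by
      by_contra hcon
      exact hl (windowArray_of_notMem hcon)
  exact (hPs _ (hmem g hk2) (hmem h hk4)).elim hk1 hk3

theorem measurableSet_defect [CompactSpace K] [Countable G] (h : G) :
    MeasurableSet {x : orbitClosure (windowArray ι E 1) |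
      (x : FullShift G (Fin 2)) h ≠ windowArray ι E (π x) h} := by
  have h1 : Measurable fun x : FullShift G (Fin 2) => x h := (continuous_coord h).measurable
  have hπm : Measurable π := (hE.continuous_address hι hπ).measurable
  exact (measurableSet_eq_fun (h1.comp measurable_subtype_coe)
    (h1.comp ((measurable_windowArray hE.isOpen).comp hπm))).compl

include hμ

/-- Almost every point of the orbit closure is determined by its address. -/
theorem ae_eq_windowArray [CompactSpace K] [Countable G] [Infinite G] :
    ∀ᵐ x : orbitClosure (windowArray ι E 1) ∂μ,
      (x : FullShift G (Fin 2)) = windowArray ι E (π x) := by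
  have := hμ.isProbabilityMeasure
  have := hμ.invariant
  set N : G → Set (orbitClosure (windowArray ι E 1)) := fun h =>
    {x | (x : FullShift G (Fin 2)) h ≠ windowArray ι E (π x) h} with hN
  have hNm : ∀ h, MeasurableSet (N h) := hE.measurableSet_defect hι hπ
  have hNeq : ∀ h, μ (N h) = μ (N 1) := by
    intro h
    rw [← measure_preimage_smul μ h⁻¹ (N 1)]
    congr 1
    ext x
    have h1 : (h⁻¹ • (x : FullShift G (Fin 2))) 1 = (x : FullShift G (Fin 2)) h := by
      change (x : FullShift G (Fin 2)) (h⁻¹⁻¹ * 1) = _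
      simp
    have h2 : windowArray ι E (π (h⁻¹ • x)) 1 = windowArray ι E (π x) h := by
      rw [hE.address_smul hι hπ, ← smul_windowArray]
      change windowArray ι E (π x) (h⁻¹⁻¹ * 1) = _
      simp
    simp only [hN, mem_ofPred_eq, mem_preimage, h2, SubMulAction.val_smul, h1]
  -- Infinitely many disjoint sets of equal positive measure do not fit into a probability space.
  have hN0 : μ (N 1) = 0 := by
    by_contra hne
    have hsum := measure_iUnion (μ := μ) (f := N)
      (fun g h hgh => disjoint_left.2 fun x hx hx' =>
        hx' (hE.defect_disjoint hι hπ hgh hx)) hNm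
    simp only [hNeq, ENNReal.tsum_const_eq_top_of_ne_zero hne] at hsum
    exact measure_ne_top μ _ hsum
  have hall : ∀ h, ∀ᵐ x : orbitClosure (windowArray ι E 1) ∂μ,
      (x : FullShift G (Fin 2)) h = windowArray ι E (π x) h := fun h => by
    have : μ (N h) = 0 := (hNeq h).trans hN0
    exact this
  filter_upwards [ae_all_iff.2 hall] with x hx
  exact funext hx

theorem map_address_eq [CompactSpace K] [TotallyDisconnectedSpace K] [SecondCountableTopology K]
    {m : Measure K} [IsProbabilityMeasure m] [m.IsMulLeftInvariant] : μ.map π = m := by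
  have := hμ.isProbabilityMeasure
  have := hμ.invariant
  have hπm : Measurable π := (hE.continuous_address hι hπ).measurable
  have := Measure.isProbabilityMeasure_map (μ := μ) hπm.aemeasurable
  refine eq_haar_of_invariant hι fun g => ?_
  ext S hS
  rw [Measure.map_apply (measurable_const_mul _) hS,
    Measure.map_apply hπm (measurable_const_mul _ hS), Measure.map_apply hπm hS,
    ← measure_preimage_smul μ g (π ⁻¹' S)]
  congr 1
  ext x
  simp only [mem_preimage, hE.address_smul hι hπ]

theorem isMeasureConjugacy_address [CompactSpace K] [T2Space K] [Countable G] [Infinite G]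
    [MulAction G K] (hact : ∀ (g : G) (y : K), g • y = ι g * y) :
    IsMeasureConjugacy G π μ (μ.map π) := by
  have hπm : Measurable π := (hE.continuous_address hι hπ).measurable
  have hae := hE.ae_eq_windowArray hι hπ hμ
  set X' : Set (orbitClosure (windowArray ι E 1)) :=
    {x | (x : FullShift G (Fin 2)) = windowArray ι E (π x)} with hX'
  set Y' : Set K := {y | windowArray ι E y ∈ orbitClosure (windowArray ι E 1)} with hY'
  have hX'm : MeasurableSet X' := by
    have : X' = ⋂ h, {x : orbitClosure (windowArray ι E 1) |
        (x : FullShift G (Fin 2)) h ≠ windowArray ι E (π x) h}ᶜ := by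
      ext x
      simp only [hX', mem_iInter, mem_compl_iff, mem_ofPred_eq, not_not]
      exact funext_iff
    rw [this]
    exact MeasurableSet.iInter fun h => (hE.measurableSet_defect hι hπ h).compl
  have hY'm : MeasurableSet Y' := measurableSet_mem_orbitClosure hE.isOpen
  have hXY : ∀ x ∈ X', π x ∈ Y' := fun x hx => by
    rw [hY', mem_ofPred_eq, ← (hx : (x : FullShift G (Fin 2)) = windowArray ι E (π x))]
    exact x.2
  have hYX : ∀ (y : K) (hy : y ∈ Y'),
      (⟨windowArray ι E y, hy⟩ : orbitClosure (windowArray ι E 1)) ∈ X' := fun y hy => by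
    rw [hX', mem_ofPred_eq, hE.address_windowArray hι hπ]
  refine ⟨hE.isFactorMap_address hι hπ hact, rfl, X', Y', hX'm, hY'm, ?_, ?_, hae, ?_,
    { toFun := fun x => ⟨π x, hXY _ x.2⟩
      invFun := fun y => ⟨⟨windowArray ι E y, y.2⟩, hYX _ _⟩
      left_inv := fun x => Subtype.ext (Subtype.ext (x.2 : _ = _).symm)
      right_inv := fun y => Subtype.ext (hE.address_windowArray hι hπ _)
      measurable_toFun := (hπm.comp measurable_subtype_coe).subtype_mk
      measurable_invFun :=
        (((measurable_windowArray hE.isOpen).comp measurable_subtype_coe).subtype_mk).subtype_mk },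
    fun x => rfl⟩
  · refine image_smul_eq_of_forall fun g x hx => ?_
    rw [hX', mem_ofPred_eq, hE.address_smul hι hπ, ← smul_windowArray,
      ← (hx : (x : FullShift G (Fin 2)) = windowArray ι E (π x))]
    rfl
  · refine image_smul_eq_of_forall fun g y hy => ?_
    rw [hact]
    exact (smul_mem_orbitClosure_iff g).2 hy
  · rw [Measure.map_apply hπm hY'm.compl]
    exact measure_mono_null (fun x hx h => hx (hXY x h)) hae

omit hμ in
theorem isUniquelyErgodic [CompactSpace K] [TotallyDisconnectedSpace K]
    [SecondCountableTopology K] [Countable G] [Infinite G] {m : Measure K}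
    [IsProbabilityMeasure m] [m.IsMulLeftInvariant] (hD : 0 < m D⁻¹) :
    IsUniquelyErgodic G (orbitClosure (windowArray ι E 1)) := by
  classical
  set Y : Set K := {y | windowArray ι E y ∈ orbitClosure (windowArray ι E 1)} with hY
  have hYm : MeasurableSet Y := measurableSet_mem_orbitClosure hE.isOpen
  have hY0 : m Yᶜ = 0 := hE.measure_mem_orbitClosure hι hD
  -- `φ` carries the Haar measure to `X` and inverts `π` almost everywhere for each invariant `μ`.
  -- Its value off the conull set `Y` is immaterial.
  set φ : K → orbitClosure (windowArray ι E 1) := fun y =>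
    if hy : y ∈ Y then ⟨windowArray ι E y, hy⟩
    else ⟨windowArray ι E 1, subset_closure (MulAction.mem_orbit_self _)⟩ with hφ
  have hφY : ∀ y (hy : y ∈ Y), φ y = ⟨windowArray ι E y, hy⟩ := fun y hy => dif_pos hy
  have hφm : Measurable φ := by
    refine Measurable.subtype_mk (f := fun y => (φ y : FullShift G (Fin 2))) ?_
    have hval : (fun y => (φ y : FullShift G (Fin 2))) =
        fun y => if y ∈ Y then windowArray ι E y else windowArray ι E 1 := by
      funext y
      by_cases hy : y ∈ Y
      · rw [hφY y hy, if_pos hy]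
      · rw [if_neg hy]
        simp only [hφ, dif_neg hy]
    rw [hval]
    exact Measurable.ite hYm (measurable_windowArray hE.isOpen) measurable_const
  have hprob : IsProbabilityMeasure (m.map φ) := Measure.isProbabilityMeasure_map hφm.aemeasurable
  refine ⟨m.map φ, ⟨hprob, ⟨fun g S hS => ?_⟩⟩, fun μ hμ => ?_⟩
  · have hgm : Measurable fun x : orbitClosure (windowArray ι E 1) => g • x :=
      ((continuous_const_smul g).comp continuous_subtype_val).measurable.subtype_mk
    rw [Measure.map_apply hφm hS, Measure.map_apply hφm (hgm hS),
      ← measure_preimage_mul m (ι g) (φ ⁻¹' S)]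
    refine measure_congr ?_
    have hae : ∀ᵐ y ∂m, y ∈ Y := hY0
    filter_upwards [hae] with y hy
    have hgy : ι g * y ∈ Y := (smul_mem_orbitClosure_iff g).2 hy
    have : g • φ y = φ (ι g * y) := by
      rw [hφY y hy, hφY _ hgy]
      exact Subtype.ext (smul_windowArray ι E y g)
    change (g • φ y ∈ S) = (φ (ι g * y) ∈ S)
    rw [this]
  · have hπm : Measurable π := (hE.continuous_address hι hπ).measurable
    rw [← hE.map_address_eq hι hπ hμ (m := m), Measure.map_map hφm hπm]
    conv_lhs => rw [← Measure.map_id (μ := μ)]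
    refine Measure.map_congr ?_
    filter_upwards [hE.ae_eq_windowArray hι hπ hμ] with x hx
    have hxY : π x ∈ Y := by
      rw [hY, mem_ofPred_eq, ← hx]
      exact x.2
    exact Subtype.ext (by rw [Function.comp_apply, hφY _ hxY]; exact hx)

end IsSparseWindow

end Measure

/-! ### Irregularity -/

section Irregular

variable {G : Type u} [Group G] {K : Type v} [Group K] [TopologicalSpace K] [IsTopologicalGroup K]
  [CompactSpace K] [TotallyDisconnectedSpace K] {ι : G →* K} {E D : Set K}

omit [TotallyDisconnectedSpace K] in
/-- The closure of the image of a finite index subgroup is open. -/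
theorem isOpen_closure_map (hι : DenseRange ι) (Γ : Subgroup G) [Γ.FiniteIndex] :
    IsOpen ((Γ.map ι).topologicalClosure : Set K) := by
  set H := (Γ.map ι).topologicalClosure with hH
  have hHc : IsClosed (H : Set K) := Subgroup.isClosed_topologicalClosure _
  let f : G ⧸ Γ → Set K := fun q => (fun z => (ι q.out)⁻¹ * z) ⁻¹' H
  have hf : ∀ q, IsClosed (f q) := fun q => hHc.preimage (continuous_const_mul _)
  have hcover : ⋃ q, f q = univ := by
    rw [← univ_subset_iff, ← hι.closure_range]
    refine closure_minimal ?_ (isClosed_iUnion_of_finite hf)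
    rintro _ ⟨g, rfl⟩
    obtain ⟨γ, hγ⟩ := QuotientGroup.mk_out_eq_mul Γ g
    refine mem_iUnion.2 ⟨(g : G ⧸ Γ), ?_⟩
    change (ι (Quotient.out (g : G ⧸ Γ)))⁻¹ * ι g ∈ H
    rw [hγ, ← map_inv, ← map_mul]
    refine Subgroup.le_topologicalClosure _ (Subgroup.mem_map_of_mem ι ?_)
    simp
  -- Baire: one of the finitely many closed translates covering `K` has interior.
  obtain ⟨q, z, hz⟩ := nonempty_interior_of_iUnion_of_closed hf hcover
  refine H.isOpen_of_mem_nhds (g := (ι q.out)⁻¹ * z) ?_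
  have hc : ContinuousAt (fun w => ι q.out * w) ((ι q.out)⁻¹ * z) :=
    (continuous_const_mul _).continuousAt
  have := hc.preimage_mem_nhds (t := f q) (by simpa using mem_interior_iff_mem_nhds.1 hz)
  simpa [f, preimage_preimage] using this

theorem IsSparseWindow.isToeplitz (hE : IsSparseWindow ι E D) :
    IsToeplitz (windowArray ι E 1) := by
  intro g
  obtain ⟨α, S, hS, hα⟩ : ∃ α : Fin 2, ∃ S ∈ 𝓝 (ι g), ∀ h, ι h ∈ S →
      windowArray ι E 1 h = α := by
    by_cases hg : ι g ∈ E
    · exact ⟨1, E, hE.isOpen.mem_nhds hg, fun h hh => windowArray_of_mem (by simpa using hh)⟩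
    · refine ⟨0, (closure E)ᶜ, isClosed_closure.isOpen_compl.mem_nhds
        (fun h => hg (hE.mem_of_mem_closure g h)), fun h hh => windowArray_of_notMem ?_⟩
      simpa using fun hh' => hh (subset_closure hh')
  obtain ⟨V, hVn, hVo, hV⟩ := exists_cosetSet_subset hS
  have : V.FiniteIndex := by
    have := V.quotient_finite_of_isOpen hVo
    exact Subgroup.finiteIndex_of_finite_quotient
  refine ⟨V.comap ι, (FiniteIndexNormalSubgroup.comap ι ⟨V, hVn, this⟩).isFiniteIndex', mem_iUnion.2 ⟨α, fun γ hγ => hα _ (hV ?_)⟩⟩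
  rw [mem_cosetSet, map_mul]
  simpa [mul_assoc] using hVn.conj_mem _ hγ (ι g)⁻¹

-- Position `1` fails: its symbol is `0`, so periodicity under `Γ` would keep `y⁻¹ * ι γ` out of `E`
-- for all `γ ∈ Γ`. But these points are dense in a neighbourhood of `y⁻¹`, a limit point of the
-- open set `E`.
omit [TotallyDisconnectedSpace K] in
theorem IsSparseWindow.not_isToeplitz (hE : IsSparseWindow ι E D) (hι : DenseRange ι) {y : K}
    (hy : y⁻¹ ∈ D) : ¬ IsToeplitz (windowArray ι E y) := by
  intro hT
  obtain ⟨Γ, hΓ, hmem⟩ := hT 1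
  obtain ⟨α, hα⟩ := mem_iUnion.1 hmem
  have hyE := hE.boundary_subset hy
  have h0 : α = 0 := by
    rw [← hα 1 Γ.one_mem, windowArray_of_notMem (by simpa using hyE.2)]
  have hΓE : ∀ γ ∈ Γ, y⁻¹ * ι γ ∉ E := fun γ hγ h => by
    have h1 := hα γ hγ
    rw [mul_one, windowArray_of_mem h, h0] at h1
    exact absurd h1 (by decide)
  have hopen : IsOpen ((fun z => y * z) ⁻¹' ((Γ.map ι).topologicalClosure : Set K)) :=
    (isOpen_closure_map hι Γ).preimage (continuous_const_mul y)
  obtain ⟨z, hz, hzE⟩ := mem_closure_iff.1 hyE.1 _ hopen (by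
    rw [mem_preimage, mul_inv_cancel]
    exact ((Γ.map ι).topologicalClosure).one_mem)
  obtain ⟨w, hw, γ, hγ, rfl⟩ := mem_closure_iff.1 hz _
    (hE.isOpen.preimage (continuous_const_mul y⁻¹)) (by simpa using hzE)
  exact hΓE γ hγ hw

variable [MeasurableSpace K] [BorelSpace K] [SecondCountableTopology K] [Countable G] [Infinite G]

theorem IsSparseWindow.isIrregularToeplitz (hE : IsSparseWindow ι E D) (hι : DenseRange ι)
    {m : Measure K} [IsProbabilityMeasure m] [m.IsMulLeftInvariant] (hD : 0 < m D⁻¹) :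
    IsIrregularToeplitz (windowArray ι E 1) := by
  refine ⟨hE.isToeplitz, ?_⟩
  rintro ⟨μ, hμ, hT⟩
  have := hμ.isProbabilityMeasure
  obtain ⟨π, hπ⟩ := exists_address hE.isOpen (ι := ι)
  have hπm : Measurable π := (hE.continuous_address hι hπ).measurable
  have hDm : MeasurableSet (D⁻¹) := hE.isClosed_boundary.inv.measurableSet
  have hpos : 0 < μ (π ⁻¹' D⁻¹) := by
    rwa [← Measure.map_apply hπm hDm, hE.map_address_eq hι hπ hμ (m := m)]
  have hle : μ {y : orbitClosure (windowArray ι E 1) | IsToeplitz (y : FullShift G (Fin 2))} ≤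
      μ (π ⁻¹' D⁻¹)ᶜ := by
    refine measure_mono_ae ?_
    filter_upwards [hE.ae_eq_windowArray hι hπ hμ] with x hx hxT hxD
    exact hE.not_isToeplitz hι hxD (hx ▸ hxT)
  rw [hT, prob_compl_eq_one_sub (hπm hDm)] at hle
  exact absurd hle (not_le.2 (ENNReal.sub_lt_self ENNReal.one_ne_top one_ne_zero hpos.ne'))

end Irregular

end ToeplitzDynamics

open ToeplitzDynamics in
theorem theorem1p1 {G : Type u} [Group G] [Countable G] [Infinite G] [Group.ResiduallyFinite G]
    {K : Type v} [Group K] [TopologicalSpace K] [IsTopologicalGroup K] [CompactSpace K]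
    [TopologicalSpace.MetrizableSpace K] [TotallyDisconnectedSpace K]
    [MeasurableSpace K] [BorelSpace K]
    (ι : G →* K) (hι_injective : Function.Injective ι) (hι_dense : DenseRange ι) :
    letI : MulAction G K := translationAction ι
    ∃ η : FullShift G (Fin 2),
      IsIrregularToeplitz η ∧
      IsMaximalEquicontinuousFactor G (orbitClosure η) K ∧
      IsTopoIsomorphicExtension G (orbitClosure η) K ∧
      IsUniquelyErgodic G (orbitClosure η) := by
  let : MulAction G K := translationAction ι
  have hact : ∀ (g : G) (y : K), g • y = ι g * y := fun _ _ => rfl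
  have : SecondCountableTopology K := by
    let := TopologicalSpace.metrizableSpaceMetric K
    infer_instance
  obtain ⟨m, _, _⟩ := exists_isMulLeftInvariant_prob (K := K)
  obtain ⟨E, D, hE, hD⟩ := exists_isSparseWindow ι hι_injective hι_dense m
  obtain ⟨π, hπ⟩ := exists_address hE.isOpen (ι := ι)
  exact ⟨windowArray ι E 1, hE.isIrregularToeplitz hι_dense hD,
    hE.isMaximalEquicontinuousFactor hι_dense hπ hact,
    ⟨π, hE.isFactorMap_address hι_dense hπ hact,
      fun μ hμ => hE.isMeasureConjugacy_address hι_dense hπ hμ hact⟩,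
    hE.isUniquelyErgodic hι_dense hπ hD⟩
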